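/- **Setting.** Let $f:[0,1]\to\mathbb R^2$ be a simple closed curve ($f$ injective on $(0,1)$, $f(0)=f(1)$), differentiable on $[0,1]$ (one-sidedly at the end points) and parameterized proportionally to arclength, i.e. $\|f'\|$ is a positive constant. Put $\Gamma_f=f([0,1])$ and let $N(u)$ be the unit normal at $f(u)$, obtained by rotating $f'(u)/\|f'(u)\|$ by a right angle. The thickness $\Delta$ of $\Gamma_f$ is the infimum of the radii of all circles through three distinct points of $\Gamma_f$. Let $0<\sigma<\Delta$ and $S=\bigcup_{u}B(f(u),\sigma)$, where $B(x,r)$ is the closed disc; the two pieces of $\partial S$ are $\partial S_0=\{f(u)+s\sigma N(u):0\le u\le1\}$ and $\partial S_1=\{f(u)-s\sigma N(u):0\le u\le1\}$, where $s\in\{1,-1\}$ (either labelling is allowed). Let $d_H$ be the Hausdorff distance. Given nonempty compact sets $\widehat{\partial S}_0,\widehat{\partial S}_1\subset\mathbb R^2$, a medial estimator is a set $\hat\Gamma=\{\tfrac12(y+\hat y): y\in\widehat{\partial S}_0\}$, where $\hat y$ is a closest point to $y$ on $\widehat{\partial S}_1$ (ties broken arbitrarily). **Theorem.** 1. There is a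 constant $C>0$, depending only on $f$ and $\sigma$, such that whenever $d_H(\partial S_0,\widehat{\partial S}_0)\le\epsilon$ and $d_H(\partial S_1,\widehat{\partial S}_1)\le\epsilon$ with $\epsilon<(\Delta-\sigma)/2$, every medial estimator $\hat\Gamma$ satisfies: (i) for every $\hat\mu\in\hat\Gamma$ there is $x\in\Gamma_f$ with $\|\hat\mu-x\|\le2\epsilon$; (ii) for every $x\in\Gamma_f$ there is $\hat\mu\in\hat\Gamma$ with $\|\hat\mu-x\|\le C\sqrt\epsilon$; (iii) $d_H(\hat\Gamma,\Gamma_f)\le C\sqrt\epsilon$. 2. Let $Y_i=f(U_i)+\epsilon_i$, $i\ge1$, where the pairs $(U_i,\epsilon_i)$ are independent and identically distributed, $U_i$ and $\epsilon_i$ are independent, $U_i$ has a density on $[0,1]$ that is bounded and bounded away from zero, and $\epsilon_i$ has a bounded density $\phi$ on $\mathbb R^2$ that vanishes outside $B(0,\sigma)$, is continuous and positive in the interior of $B(0,\sigma)$, depends only on $\|x\|$ and is nonincreasing in $\|x\|$, and satisfies $\phi(x)\sim a(\sigma-\|x\|)^\beta$ as $\|x\|\uparrow\sigma$ for some $a>0$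 and $0\le\beta<\infty$. Put $\alpha=\beta+\tfrac12$, $r_n=(\log n/n)^{1/(2+\alpha)}$ and $\hat S=\hat S_n=\bigcup_{i=1}^nB(Y_i,Cr_n)$. (a) For every $C>\sqrt{2/(\chi\pi)}$ with $\chi=1/4$ there is a constant $K>0$ such that, with probability one, for all large $n$, $d_H(\Gamma_f,\hat\Gamma)\le K\sqrt{r_n}$ for every medial estimator $\hat\Gamma$ built from two disjoint simple closed curves $\widehat{\partial S}_0,\widehat{\partial S}_1$ (in either order) whose union is $\partial\hat S$. The same bound holds for every medial estimator built from the two parts of $\partial\hat S$ that consist of the points at least as close to $\partial S_0$ as to $\partial S_1$, and of the points at least as close to $\partial S_1$ as to $\partial S_0$; with probability one both parts are nonempty for all large $n$. (b) There is $C_0$, depending on $f$, $\sigma$ and the two densities, such that for every $C>C_0$, with probability one, for all large $n$, $\partial\hat S$ is the union of two disjoint simple closed curves. -/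

import Mathlib

open Set Filter Topology MeasureTheory ProbabilityTheory Metric

/-- The Euclidean plane. -/
abbrev Plane : Type := EuclideanSpace ℝ (Fin 2)

/-- The filament `Γ_f`, the image of `[0,1]` under `f`. Only the values of `f` on `[0,1]` matter. -/
def filament (f : ℝ → Plane) : Set Plane := f '' Icc 0 1

/-- A smooth simple closed filament, parameterized proportionally to arclength: differentiable on
`[0,1]` (one-sidedly at the end points) with derivative of constant nonzero norm, injective on
`(0,1)`, and with `f 0 = f 1`. -/
structure IsClosedFilament (f : ℝ → Plane) : Prop where
  differentiableOn : DifferentiableOn ℝ f (Icc 0 1)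
  constant_speed : ∃ ℓ : ℝ, 0 < ℓ ∧ ∀ u ∈ Icc (0 : ℝ) 1, ‖derivWithin f (Icc 0 1) u‖ = ℓ
  simple : InjOn f (Ioo 0 1)
  closed : f 0 = f 1

/-- The thickness `Δ`: the infimum of the radii of the circles that pass through three distinct
points of `Γ`. (Collinear triples lie on no circle and do not contribute. A closed filament has
non-collinear triples, so this is the infimum of a nonempty set of nonnegative reals.) -/
noncomputable def thickness (Γ : Set Plane) : ℝ :=
  sInf {r : ℝ | ∃ c : Plane, ∃ x ∈ Γ, ∃ y ∈ Γ, ∃ z ∈ Γ, x ≠ y ∧ y ≠ z ∧ x ≠ z ∧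
    dist x c = r ∧ dist y c = r ∧ dist z c = r}

/-- Rotation of the plane by a right angle. -/
def rot (v : Plane) : Plane := !₂[-v 1, v 0]

/-- The unit normal vector `N(u)` at `f u`. -/
noncomputable def unitNormal (f : ℝ → Plane) (u : ℝ) : Plane :=
  ‖derivWithin f (Icc 0 1) u‖⁻¹ • rot (derivWithin f (Icc 0 1) u)

/-- For `s = 1` and `s = -1`, the two pieces `{f(u) + s σ N(u)}` of the boundary of
`S = ⋃ u, B(f(u), σ)`. -/
noncomputable def boundaryCurve (f : ℝ → Plane) (σ s : ℝ) : Set Plane :=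
  (fun u => f u + (s * σ) • unitNormal f u) '' Icc 0 1

/-- `Γhat` is a medial estimator built from the boundary estimates `A₀`, `A₁`: the set of midpoints
of the segments that join each `y ∈ A₀` to a closest point `p y` of `A₁` (ties are broken
arbitrarily). -/
def IsMedialEstimator (A₀ A₁ Γhat : Set Plane) : Prop :=
  ∃ p : Plane → Plane, (∀ y ∈ A₀, p y ∈ A₁ ∧ dist y (p y) = infDist y A₁) ∧
    Γhat = (fun y => midpoint ℝ y (p y)) '' A₀

/-- `h` restricted to `[0,1]` is bounded and bounded away from zero. -/
structure IsPositionDensity (h : ℝ → ℝ) : Prop where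
  measurable : Measurable h
  bounds : ∃ c₁ c₂ : ℝ, 0 < c₁ ∧ ∀ u ∈ Icc (0 : ℝ) 1, c₁ ≤ h u ∧ h u ≤ c₂

/-- The law on `[0,1]` with density `h`. -/
noncomputable def positionLaw (h : ℝ → ℝ) : Measure ℝ :=
  (volume.restrict (Icc 0 1)).withDensity fun u => ENNReal.ofReal (h u)

/-- The conditions on the noise density: support `B(0,σ)`, boundedness, continuity and positivity
in the interior of the support (the uniform density on the disc is allowed), radial monotonicity
and symmetry, and `φ(x) ∼ a (σ - ‖x‖)^β` as `‖x‖` increases to `σ`. -/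
structure IsNoiseDensity (φ : Plane → ℝ) (σ β : ℝ) : Prop where
  measurable : Measurable φ
  nonneg : ∀ x, 0 ≤ φ x
  support : ∀ x, σ < ‖x‖ → φ x = 0
  bounded : ∃ b, ∀ x, φ x ≤ b
  continuousOn : ContinuousOn φ (ball 0 σ)
  pos : ∀ x ∈ ball (0 : Plane) σ, 0 < φ x
  nonincreasing : ∀ x y, ‖x‖ ≤ ‖y‖ → φ y ≤ φ x
  symmetric : ∀ x y, ‖x‖ = ‖y‖ → φ x = φ y
  boundary_behavior : 0 ≤ β ∧ ∃ a : ℝ, 0 < a ∧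
    Asymptotics.IsEquivalent (comap norm (𝓝[<] σ)) φ fun x : Plane => a * (σ - ‖x‖) ^ β

/-- The law on the plane with density `φ`. -/
noncomputable def noiseLaw (φ : Plane → ℝ) : Measure Plane :=
  volume.withDensity fun x => ENNReal.ofReal (φ x)

/-- The pairs `(U i, e i)` are independent, each with law `positionLaw h × noiseLaw φ`. -/
structure IsFilamentSample {Ω : Type*} [MeasurableSpace Ω] (P : Measure Ω)
    (h : ℝ → ℝ) (φ : Plane → ℝ) (U : ℕ → Ω → ℝ) (e : ℕ → Ω → Plane) : Prop where
  indep : iIndepFun (fun i ω => (U i ω, e i ω)) P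
  law : ∀ i, HasLaw (fun ω => (U i ω, e i ω)) ((positionLaw h).prod (noiseLaw φ)) P

/-- The rate `r_n = (log n / n)^(1/(2+α))` with `α = β + 1/2`. -/
noncomputable def rate (β : ℝ) (n : ℕ) : ℝ :=
  (Real.log n / n) ^ (1 / (2 + (β + 1 / 2)))

/-- The union of the closed balls of radius `r` around the first `n` of the points `Y`. -/
def unionOfBalls (Y : ℕ → Plane) (n : ℕ) (r : ℝ) : Set Plane :=
  ⋃ i ∈ Finset.range n, closedBall (Y i) r

/-- `A` is a simple closed curve. -/
def IsSimpleClosedCurve (A : Set Plane) : Prop :=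
  ∃ γ : ℝ → Plane, ContinuousOn γ (Icc 0 1) ∧ γ 0 = γ 1 ∧ InjOn γ (Ico 0 1) ∧
    γ '' Icc 0 1 = A

/-- `A₀` and `A₁` are two disjoint simple closed curves that together make up `D`. -/
structure IsTwoCurveSplitting (D A₀ A₁ : Set Plane) : Prop where
  curve₀ : IsSimpleClosedCurve A₀
  curve₁ : IsSimpleClosedCurve A₁
  disjoint : Disjoint A₀ A₁
  union : A₀ ∪ A₁ = D

/-- The part of an estimated boundary `D` on the side of the boundary curve with sign `s`: its
points that are at least as close to this curve as to the other one. -/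
noncomputable def boundaryPart (f : ℝ → Plane) (σ s : ℝ) (D : Set Plane) : Set Plane :=
  {x ∈ D | infDist x (boundaryCurve f σ s) ≤ infDist x (boundaryCurve f σ (-s))}

/-!
A thickness bound for `Γ` says that every triangle with vertices on `Γ` has circumradius at least
`Δ`. Letting two vertices merge shows that, at each point of `Γ`, the curve stays outside the two
open discs of radius `Δ` tangent to it, and comparing the tangents at the two ends of a chord shows
that the unit tangent is Lipschitz. Every point of the plane lies on the normal line at any of its
closest points of `Γ`, so the two sets of points reached along `N` and along `-N` cover the plane;
both are closed and connected. As the plane is unicoherent, their intersection is connected; its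
points at distance less than `Δ` from `Γ` lie on `Γ`, so it is `Γ`. This gives a `1`-Lipschitz
signed distance `g` with `g (f u + t • N u) = t` for `|t| ≤ Δ`, and the curves `∂S₀`, `∂S₁` are the
level sets `g = ± σ`.

If `g y` and `g z` are within `ε` of `σ` and `-σ`, and `‖y - z‖ ≤ 2σ + 2ε`, then the Lipschitz
property bounds `g` at the midpoint by `2ε`. The disc of radius `2σ` around a point of `∂S₀` is
tangent to `∂S₁` at the antipodal point, so an almost closest point is only located up to an error
of order `√ε`.

For the random part, a ball of radius of order `r` centred at depth of order `r` inside `S` is hit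
by one observation with probability of order at least `r ^ (2 + α)`: the foot point may move by
`√r` along `Γ`, the noise has a target of area `r ^ 2`, and its density is there of order `r ^ β`.
By Borel–Cantelli over a fine grid, all points at depth `K r_n` are eventually covered, so the
boundary of the union of balls is close to `∂S`. If the radius is large compared with the depth,
the union meets each normal, beyond `Γ`, in a segment whose length depends continuously on the foot
point; the two graphs of this length over `Γ` are the two closed curves.
-/

/-- The determinant of two vectors of the plane. -/
def cross (p q : Plane) : ℝ := p 0 * q 1 - p 1 * q 0

lemma plane_inner (p q : Plane) : inner ℝ p q = p 0 * q 0 + p 1 * q 1 := by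
  simp [PiLp.inner_apply, Fin.sum_univ_two, mul_comm]

lemma plane_norm_sq (p : Plane) : ‖p‖ ^ 2 = p 0 ^ 2 + p 1 ^ 2 := by
  simp [EuclideanSpace.norm_sq_eq, Fin.sum_univ_two]

lemma plane_ext {p q : Plane} (h0 : p 0 = q 0) (h1 : p 1 = q 1) : p = q := by
  ext i; fin_cases i <;> assumption

@[simp] lemma rot_zero_apply (p : Plane) : rot p 0 = -p 1 := by simp [rot]

@[simp] lemma rot_one_apply (p : Plane) : rot p 1 = p 0 := by simp [rot]

lemma rot_smul (t : ℝ) (p : Plane) : rot (t • p) = t • rot p := by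
  apply plane_ext <;> simp

lemma norm_rot (p : Plane) : ‖rot p‖ = ‖p‖ := by
  rw [← sq_eq_sq₀ (norm_nonneg _) (norm_nonneg _), plane_norm_sq, plane_norm_sq, rot_zero_apply,
    rot_one_apply]
  ring

lemma continuous_rot : Continuous rot := by
  unfold rot
  fun_prop

@[fun_prop]
lemma continuous_cross {X : Type*} [TopologicalSpace X] {p q : X → Plane} (hp : Continuous p)
    (hq : Continuous q) : Continuous fun x => cross (p x) (q x) := by
  unfold cross
  fun_prop

lemma inner_rot (p q : Plane) : inner ℝ (rot p) q = cross p q := by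
  rw [plane_inner, cross, rot_zero_apply, rot_one_apply]; ring

lemma cross_smul_left (t : ℝ) (p q : Plane) : cross (t • p) q = t * cross p q := by
  simp only [cross, PiLp.smul_apply, smul_eq_mul]; ring

lemma cross_smul_right (t : ℝ) (p q : Plane) : cross p (t • q) = t * cross p q := by
  simp only [cross, PiLp.smul_apply, smul_eq_mul]; ring

lemma abs_cross_comm (p q : Plane) : |cross p q| = |cross q p| := by
  rw [← abs_neg, cross, cross]; ring_nf

lemma inner_sq_add_cross_sq (p q : Plane) :
    (inner ℝ p q) ^ 2 + cross p q ^ 2 = ‖p‖ ^ 2 * ‖q‖ ^ 2 := by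
  rw [plane_inner, cross, plane_norm_sq, plane_norm_sq]; ring

lemma abs_cross_eq_of_inner_eq_zero {p q : Plane} (h : inner ℝ p q = 0) :
    |cross p q| = ‖p‖ * ‖q‖ := by
  rw [← sq_eq_sq₀ (abs_nonneg _) (by positivity), sq_abs, mul_pow, ← inner_sq_add_cross_sq, h]
  ring

lemma sin_angle_mul_norm_mul_norm_eq_abs_cross (p q : Plane) :
    Real.sin (InnerProductGeometry.angle p q) * (‖p‖ * ‖q‖) = |cross p q| := by
  rw [InnerProductGeometry.sin_angle_mul_norm_mul_norm, ← Real.sqrt_sq_eq_abs,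
    real_inner_self_eq_norm_sq, real_inner_self_eq_norm_sq]
  congr 1
  linear_combination -inner_sq_add_cross_sq p q

lemma affineIndependent_of_cross_ne_zero {a b c : Plane} (h : cross (b - a) (c - a) ≠ 0) :
    AffineIndependent ℝ ![a, b, c] := by
  rw [affineIndependent_iff_not_collinear_set, collinear_iff_of_mem (mem_insert a _)]
  rintro ⟨v, hv⟩
  obtain ⟨r, rfl⟩ := hv b (by simp)
  obtain ⟨t, rfl⟩ := hv c (by simp)
  apply h
  rw [vadd_eq_add, vadd_eq_add, add_sub_cancel_right, add_sub_cancel_right, cross_smul_left,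
    cross_smul_right, cross]
  ring

/-- Every circle through three points of `Γ` has radius at least `Δ`, expressed by the formula
`|b - a| |c - b| |c - a| / (2 |cross (b - a) (c - a)|)` for the circumradius. -/
def ThreePointBound (Γ : Set Plane) (Δ : ℝ) : Prop :=
  ∀ a ∈ Γ, ∀ b ∈ Γ, ∀ c ∈ Γ, 2 * Δ * |cross (b - a) (c - a)| ≤ ‖b - a‖ * ‖c - b‖ * ‖c - a‖

lemma thickness_le_circumradius {Γ : Set Plane} (t : Affine.Triangle ℝ Plane)
    (ht : ∀ i, t.points i ∈ Γ) : thickness Γ ≤ t.circumradius := by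
  refine csInf_le ⟨0, ?_⟩ ⟨t.circumcenter, t.points 0, ht 0, t.points 1, ht 1, t.points 2, ht 2,
    t.independent.injective.ne (by decide), t.independent.injective.ne (by decide),
    t.independent.injective.ne (by decide), t.dist_circumcenter_eq_circumradius 0,
    t.dist_circumcenter_eq_circumradius 1, t.dist_circumcenter_eq_circumradius 2⟩
  rintro r ⟨c, x, -, y, -, z, -, -, -, -, rfl, -⟩
  exact dist_nonneg

lemma threePointBound_thickness (Γ : Set Plane) : ThreePointBound Γ (thickness Γ) := by
  intro a ha b hb c hc
  by_cases hD : cross (b - a) (c - a) = 0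
  · rw [hD, abs_zero, mul_zero]; positivity
  let t : Affine.Triangle ℝ Plane := ⟨![a, b, c], affineIndependent_of_cross_ne_zero hD⟩
  have thickness_le : thickness Γ ≤ t.circumradius :=
    thickness_le_circumradius t fun i => by fin_cases i <;> assumption
  have law_of_sines : dist b c / Real.sin (EuclideanGeometry.angle b a c) = 2 * t.circumradius :=
    t.dist_div_sin_angle_eq_two_mul_circumradius (i₁ := 1) (i₂ := 0) (i₃ := 2)
      (by decide) (by decide) (by decide)
  have area : Real.sin (EuclideanGeometry.angle b a c) * (‖b - a‖ * ‖c - a‖) =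
      |cross (b - a) (c - a)| := sin_angle_mul_norm_mul_norm_eq_abs_cross _ _
  have sin_ne : Real.sin (EuclideanGeometry.angle b a c) ≠ 0 := by
    intro h
    rw [h, zero_mul, eq_comm, abs_eq_zero] at area
    exact hD area
  rw [div_eq_iff sin_ne, dist_comm, dist_eq_norm] at law_of_sines
  calc 2 * thickness Γ * |cross (b - a) (c - a)|
      ≤ 2 * t.circumradius * |cross (b - a) (c - a)| := by gcongr
    _ = ‖b - a‖ * ‖c - b‖ * ‖c - a‖ := by rw [← area, law_of_sines]; ring

lemma eventually_mem_cone_of_hasDerivWithinAt {E : Type*} [NormedAddCommGroup E]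
    [InnerProductSpace ℝ E] {γ : ℝ → E} {v : E} {x : ℝ} (hv : v ≠ 0)
    (hγ : HasDerivWithinAt γ v (Ioi x) x) :
    ∀ᶠ s in 𝓝[>] x, 0 < inner ℝ v (γ s - γ x) ∧
      ‖v‖ * ‖γ s - γ x‖ ≤ 2 * inner ℝ v (γ s - γ x) := by
  have hv' : 0 < ‖v‖ := norm_pos_iff.2 hv
  have hquarter : 0 < ‖v‖ / 4 := by positivity
  filter_upwards [(hasDerivWithinAt_iff_isLittleO.1 hγ).def hquarter, self_mem_nhdsWithin]
    with s hs hxs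
  have hxs : 0 < s - x := sub_pos.2 hxs
  set r := γ s - γ x - (s - x) • v
  have hγs : γ s - γ x = (s - x) • v + r := by simp [r]
  rw [Real.norm_of_nonneg hxs.le] at hs
  have hpos : 0 < (s - x) * ‖v‖ ^ 2 := by positivity
  have hinner : 3 / 4 * ((s - x) * ‖v‖ ^ 2) ≤ inner ℝ v (γ s - γ x) := by
    have := neg_le_of_abs_le ((abs_real_inner_le_norm v r).trans
      (mul_le_mul_of_nonneg_left hs hv'.le))
    rw [hγs, inner_add_right, inner_smul_right, real_inner_self_eq_norm_sq]
    linarith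
  have hnorm : ‖γ s - γ x‖ ≤ 5 / 4 * ((s - x) * ‖v‖) := by
    rw [hγs]
    refine (norm_add_le _ _).trans ?_
    rw [norm_smul, Real.norm_of_nonneg hxs.le]
    linarith
  refine ⟨by linarith, ?_⟩
  have := mul_le_mul_of_nonneg_left hnorm hv'.le
  linarith

namespace ThreePointBound

variable {Γ : Set Plane} {Δ : ℝ} {p x y v : Plane}

lemma eq_of_inner_eq (hΓ : ThreePointBound Γ Δ) (hp : p ∈ Γ) (hx : x ∈ Γ) (hy : y ∈ Γ)
    (hxc : ‖v‖ * ‖x - p‖ ≤ 2 * inner ℝ v (x - p)) (hyc : ‖v‖ * ‖y - p‖ ≤ 2 * inner ℝ v (y - p))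
    (hxy : inner ℝ v (y - p) = inner ℝ v (x - p)) (h0 : 0 < inner ℝ v (x - p))
    (hlt : 2 * inner ℝ v (x - p) < Δ * ‖v‖) : x = y := by
  by_contra hne
  have hpos : 0 < ‖y - x‖ := norm_pos_iff.2 (sub_ne_zero.2 (Ne.symm hne))
  have hperp : inner ℝ v (y - x) = 0 := by
    rw [← sub_sub_sub_cancel_right y x p, inner_sub_right, hxy, sub_self]
  have hcross : ‖v‖ * |cross (x - p) (y - p)| = inner ℝ v (x - p) * ‖y - x‖ := by
    have hcoord : ‖v‖ ^ 2 * cross (x - p) (y - p) = inner ℝ v (x - p) * cross v (y - x) := by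
      rw [plane_inner] at hperp ⊢
      simp only [cross, plane_norm_sq, PiLp.sub_apply] at hperp ⊢
      linear_combination -(v 0 * (x 1 - p 1) - v 1 * (x 0 - p 0)) * hperp
    have hv : 0 < ‖v‖ := norm_pos_iff.2 fun h => by simp [h] at h0
    apply mul_left_cancel₀ hv.ne'
    rw [← mul_assoc, ← sq, ← abs_of_pos (sq_pos_of_pos hv), ← abs_mul, hcoord, abs_mul,
      abs_of_pos h0, abs_cross_eq_of_inner_eq_zero hperp]
    ring
  rw [hxy] at hyc
  have : Δ * ‖v‖ * (2 * inner ℝ v (x - p) * ‖y - x‖) ≤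
      2 * inner ℝ v (x - p) * (2 * inner ℝ v (x - p) * ‖y - x‖) := by
    calc Δ * ‖v‖ * (2 * inner ℝ v (x - p) * ‖y - x‖)
        = ‖v‖ ^ 2 * (2 * Δ * |cross (x - p) (y - p)|) := by
          linear_combination -2 * Δ * ‖v‖ * hcross
      _ ≤ ‖v‖ ^ 2 * (‖x - p‖ * ‖y - x‖ * ‖y - p‖) :=
          mul_le_mul_of_nonneg_left (hΓ p hp x hx y hy) (sq_nonneg _)
      _ = ‖v‖ * ‖x - p‖ * (‖v‖ * ‖y - p‖) * ‖y - x‖ := by ring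
      _ ≤ 2 * inner ℝ v (x - p) * (2 * inner ℝ v (x - p)) * ‖y - x‖ := by gcongr
      _ = _ := by ring
  exact hlt.not_ge (le_of_mul_le_mul_right this (by positivity))

lemma arcs_meet (hΓ : ThreePointBound Γ Δ) (hΔ : 0 < Δ) (hp : p ∈ Γ) (hv : v ≠ 0)
    {γ₁ γ₂ : ℝ → Plane} {η : ℝ} (hη : 0 < η) (h₁ : γ₁ 0 = p) (h₂ : γ₂ 0 = p)
    (hΓ₁ : ∀ s ∈ Ioo 0 η, γ₁ s ∈ Γ) (hΓ₂ : ∀ s ∈ Ioo 0 η, γ₂ s ∈ Γ)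
    (hc : ContinuousOn γ₂ (Ico 0 η)) (hd₁ : HasDerivWithinAt γ₁ v (Ioi 0) 0)
    (hd₂ : HasDerivWithinAt γ₂ v (Ioi 0) 0) :
    ∃ s ∈ Ioo 0 η, ∃ t ∈ Ioo 0 η, γ₁ s = γ₂ t := by
  have cone₁ := eventually_mem_cone_of_hasDerivWithinAt hv hd₁
  have cone₂ := eventually_mem_cone_of_hasDerivWithinAt hv hd₂
  rw [h₁] at cone₁
  rw [h₂] at cone₂
  have hη' : ∀ᶠ s in 𝓝[>] (0 : ℝ), s ∈ Ioo 0 η := Ioo_mem_nhdsGT hη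
  obtain ⟨δ, hδ, hcone₂⟩ := (mem_nhdsGT_iff_exists_Ioo_subset).1 (cone₂.and hη')
  obtain ⟨t₀, ht₀, ht₀δ⟩ := exists_between (mem_Ioi.1 hδ)
  obtain ⟨⟨ht₀_pos, -⟩, ht₀η⟩ := hcone₂ ⟨ht₀, ht₀δ⟩
  have htend : Tendsto (fun s => inner ℝ v (γ₁ s - p)) (𝓝[>] 0) (𝓝 0) := by
    have h := hd₁.continuousWithinAt.tendsto
    rw [h₁] at h
    simpa using (tendsto_const_nhds (x := v)).inner (𝕜 := ℝ) (h.sub_const p)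
  have hΔv : 0 < Δ * ‖v‖ / 2 := by have := norm_pos_iff.2 hv; positivity
  obtain ⟨s, ⟨hs_pos, hs_cone⟩, hsη, hs_lt, hs_small⟩ := (cone₁.and (hη'.and
    ((htend.eventually (gt_mem_nhds ht₀_pos)).and
      (htend.eventually (gt_mem_nhds hΔv))))).exists
  have hcont : ContinuousOn (fun t => inner ℝ v (γ₂ t - p)) (Icc 0 t₀) :=
    continuousOn_const.inner ((hc.mono fun t ht => ⟨ht.1, ht.2.trans_lt ht₀η.2⟩).sub
      continuousOn_const)
  obtain ⟨t, ht, hst⟩ := intermediate_value_Ioo ht₀.le hcont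
    (show inner ℝ v (γ₁ s - p) ∈ Ioo _ _ from ⟨by simpa [h₂] using hs_pos, hs_lt⟩)
  obtain ⟨⟨-, ht_cone⟩, htη⟩ := hcone₂ ⟨ht.1, ht.2.trans ht₀δ⟩
  exact ⟨s, hsη, t, htη, hΓ.eq_of_inner_eq hp (hΓ₁ s hsη) (hΓ₂ t htη) hs_cone ht_cone hst hs_pos
    (by linarith)⟩

end ThreePointBound

/-- `f` is a closed curve on `[0,1]` with speed `ℓ > 0` and unit tangent `T`, whose image satisfies
the three-point bound of thickness `Δ`. -/
structure IsThickCurve (f T : ℝ → Plane) (ℓ Δ : ℝ) : Prop where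
  speed_pos : 0 < ℓ
  thickness_pos : 0 < Δ
  hasDeriv : ∀ u ∈ Icc (0 : ℝ) 1, HasDerivWithinAt f (ℓ • T u) (Icc 0 1) u
  norm_tangent : ∀ u ∈ Icc (0 : ℝ) 1, ‖T u‖ = 1
  bound : ThreePointBound (filament f) Δ
  simple : InjOn f (Ioo 0 1)
  closed : f 0 = f 1

lemma IsClosedFilament.exists_isThickCurve {f : ℝ → Plane} (hf : IsClosedFilament f)
    (hΔ : 0 < thickness (filament f)) :
    ∃ (T : ℝ → Plane) (ℓ : ℝ), IsThickCurve f T ℓ (thickness (filament f)) ∧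
      ∀ u, unitNormal f u = rot (T u) := by
  obtain ⟨ℓ, hℓ, h⟩ := hf.constant_speed
  refine ⟨fun u => ‖derivWithin f (Icc 0 1) u‖⁻¹ • derivWithin f (Icc 0 1) u, ℓ,
    ⟨hℓ, hΔ, fun u hu => ?_, fun u hu => ?_, threePointBound_thickness _, hf.simple, hf.closed⟩,
    fun u => by rw [rot_smul, unitNormal]⟩
  · simp only [h u hu, smul_smul, mul_inv_cancel₀ hℓ.ne', one_smul]
    exact (hf.differentiableOn u hu).hasDerivWithinAt
  · rw [norm_smul, norm_inv, norm_norm, h u hu, inv_mul_cancel₀ hℓ.ne']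

lemma isCompact_filament {f : ℝ → Plane} (hf : ContinuousOn f (Icc 0 1)) :
    IsCompact (filament f) :=
  isCompact_Icc.image_of_continuousOn hf

lemma mem_filament (f : ℝ → Plane) {u : ℝ} (hu : u ∈ Icc (0 : ℝ) 1) : f u ∈ filament f :=
  mem_image_of_mem f hu

lemma filament_nonempty (f : ℝ → Plane) : (filament f).Nonempty :=
  (nonempty_Icc.2 zero_le_one).image f

namespace IsThickCurve

variable {f T : ℝ → Plane} {ℓ Δ : ℝ} {u v : ℝ}

lemma continuousOn (h : IsThickCurve f T ℓ Δ) : ContinuousOn f (Icc 0 1) :=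
  fun u hu => (h.hasDeriv u hu).continuousWithinAt

lemma norm_sub_le (h : IsThickCurve f T ℓ Δ) (hu : u ∈ Icc (0 : ℝ) 1) (hv : v ∈ Icc (0 : ℝ) 1) :
    ‖f v - f u‖ ≤ ℓ * |v - u| := by
  refine (convex_Icc (0 : ℝ) 1).norm_image_sub_le_of_norm_hasDerivWithin_le h.hasDeriv
    (fun x hx => ?_) hu hv
  rw [norm_smul, h.norm_tangent x hx, Real.norm_of_nonneg h.speed_pos.le, mul_one]

lemma smul_tangent_ne_zero (h : IsThickCurve f T ℓ Δ) (hu : u ∈ Icc (0 : ℝ) 1) {a : ℝ}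
    (ha : a ≠ 0) : a • ℓ • T u ≠ 0 := by
  refine smul_ne_zero ha (smul_ne_zero h.speed_pos.ne' fun h0 => ?_)
  simpa [h0] using h.norm_tangent u hu

lemma mul_abs_cross_tangent_le (h : IsThickCurve f T ℓ Δ) (hu : u ∈ Icc (0 : ℝ) 1) {q : Plane}
    {c : ℝ} {K : Plane → ℝ} (hK : Continuous K)
    (hle : ∀ x ∈ filament f, c * |cross (x - f u) q| ≤ ‖x - f u‖ * K x) :
    c * |cross (T u) q| ≤ K (f u) := by
  have : (𝓝[Icc 0 1 \ {u}] u).NeBot :=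
    accPt_principal_iff_nhdsWithin.1 (uniqueDiffOn_Icc_zero_one u hu).accPt
  have slope_tendsto := hasDerivWithinAt_iff_tendsto_slope.1 (h.hasDeriv u hu)
  have f_tendsto : Tendsto f (𝓝[Icc 0 1 \ {u}] u) (𝓝 (f u)) :=
    (h.hasDeriv u hu).continuousWithinAt.mono_left (nhdsWithin_mono _ sdiff_subset)
  have lhs_tendsto : Tendsto (fun v => c * |cross (slope f u v) q|) (𝓝[Icc 0 1 \ {u}] u)
      (𝓝 (c * |cross (ℓ • T u) q|)) := by
    have : Continuous fun w : Plane => c * |cross w q| := by fun_prop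
    exact (this.tendsto _).comp slope_tendsto
  have hlim : c * |cross (ℓ • T u) q| ≤ ‖ℓ • T u‖ * K (f u) := by
    refine le_of_tendsto_of_tendsto lhs_tendsto
      (slope_tendsto.norm.mul ((hK.tendsto _).comp f_tendsto)) ?_
    filter_upwards [self_mem_nhdsWithin] with v hv
    have := mul_le_mul_of_nonneg_left (hle (f v) (mem_filament f hv.1)) (abs_nonneg (v - u)⁻¹)
    rw [slope_def_module, cross_smul_left, norm_smul, abs_mul, Real.norm_eq_abs, mul_left_comm,
      mul_assoc]
    exact this
  rw [cross_smul_left, norm_smul, h.norm_tangent u hu, abs_mul, abs_of_pos h.speed_pos,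
    Real.norm_of_nonneg h.speed_pos.le, mul_one, mul_left_comm] at hlim
  exact le_of_mul_le_mul_left hlim h.speed_pos

lemma tangency (h : IsThickCurve f T ℓ Δ) (hu : u ∈ Icc (0 : ℝ) 1) {c : Plane}
    (hc : c ∈ filament f) : 2 * Δ * |cross (T u) (c - f u)| ≤ ‖c - f u‖ ^ 2 := by
  rw [sq]
  refine h.mul_abs_cross_tangent_le hu (K := fun x => ‖c - x‖ * ‖c - f u‖) (by fun_prop)
    fun x hx => ?_
  rw [← mul_assoc]
  exact h.bound (f u) (mem_filament f hu) x hx c hc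

lemma cross_tangent_eq_zero (h : IsThickCurve f T ℓ Δ) (hu : u ∈ Icc (0 : ℝ) 1)
    (hv : v ∈ Icc (0 : ℝ) 1) (huv : f u = f v) : cross (T u) (T v) = 0 := by
  have hle : 2 * Δ * |cross (T v) (T u)| ≤ ‖f v - f v‖ := by
    refine h.mul_abs_cross_tangent_le hv (K := fun x => ‖x - f v‖) (by fun_prop) fun x hx => ?_
    rw [abs_cross_comm, ← sq, ← huv]
    exact h.tangency hu hx
  rw [sub_self, norm_zero, abs_cross_comm] at hle
  have := h.thickness_pos
  exact abs_eq_zero.1 (le_antisymm (nonpos_of_mul_nonpos_right hle (by positivity))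
    (abs_nonneg _))

lemma tangent_eq_or_eq_neg (h : IsThickCurve f T ℓ Δ) (hu : u ∈ Icc (0 : ℝ) 1)
    (hv : v ∈ Icc (0 : ℝ) 1) (huv : f u = f v) : T v = T u ∨ T v = -T u := by
  have hnu := h.norm_tangent u hu
  have hnv := h.norm_tangent v hv
  have hsq := inner_sq_add_cross_sq (T u) (T v)
  rw [h.cross_tangent_eq_zero hu hv huv, hnu, hnv] at hsq
  rcases sq_eq_sq_iff_eq_or_eq_neg.1 (by linarith : inner ℝ (T u) (T v) ^ 2 = 1 ^ 2) with h1 | h1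
  · exact .inl ((inner_eq_one_iff_of_norm_eq_one hnu hnv).1 h1).symm
  · exact .inr (neg_eq_iff_eq_neg.1 ((inner_eq_neg_one_iff_of_norm_eq_one hnu hnv).1 h1).symm)

lemma hasDerivWithinAt_arc (h : IsThickCurve f T ℓ Δ) (hu : u ∈ Icc (0 : ℝ) 1) {a η : ℝ}
    (hη : 0 < η) (hmem : ∀ s ∈ Ioo 0 η, u + a * s ∈ Icc (0 : ℝ) 1) :
    HasDerivWithinAt (fun s => f (u + a * s)) (a • ℓ • T u) (Ioi 0) 0 := by
  have hparam : HasDerivWithinAt (fun s : ℝ => u + a * s) a (Ioo 0 η) 0 := by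
    simpa using (((hasDerivAt_id (0 : ℝ)).const_mul a).const_add u).hasDerivWithinAt
  exact ((h.hasDeriv u hu).scomp_of_eq (0 : ℝ) hparam hmem (by simp)).mono_of_mem_nhdsWithin
    (Ioo_mem_nhdsGT hη)

lemma exists_apply_arc_eq (h : IsThickCurve f T ℓ Δ) (hu : u ∈ Icc (0 : ℝ) 1)
    (hv : v ∈ Icc (0 : ℝ) 1) (huv : f u = f v) {a b η : ℝ} (ha : a ≠ 0) (hη : 0 < η)
    (hT : a • T u = b • T v) (hu_mem : ∀ s ∈ Ioo 0 η, u + a * s ∈ Icc (0 : ℝ) 1)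
    (hv_mem : ∀ s ∈ Ioo 0 η, v + b * s ∈ Icc (0 : ℝ) 1) :
    ∃ s ∈ Ioo 0 η, ∃ t ∈ Ioo 0 η, f (u + a * s) = f (v + b * t) := by
  have hv_mem' : ∀ s ∈ Ico 0 η, v + b * s ∈ Icc (0 : ℝ) 1 := by
    intro s hs
    rcases hs.1.eq_or_lt with rfl | hs0
    · simpa using hv
    · exact hv_mem s ⟨hs0, hs.2⟩
  have hderiv := h.hasDerivWithinAt_arc hv hη hv_mem
  rw [smul_comm, ← hT, smul_comm] at hderiv
  exact h.bound.arcs_meet h.thickness_pos (mem_filament f hu) (h.smul_tangent_ne_zero hu ha) hη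
    (γ₁ := fun s => f (u + a * s)) (γ₂ := fun s => f (v + b * s)) (by simp) (by simp [huv])
    (fun s hs => mem_filament f (hu_mem s hs)) (fun s hs => mem_filament f (hv_mem s hs))
    (h.continuousOn.comp (by fun_prop) hv_mem') (h.hasDerivWithinAt_arc hu hη hu_mem) hderiv

lemma tangent_closed (h : IsThickCurve f T ℓ Δ) : T 1 = T 0 := by
  refine (h.tangent_eq_or_eq_neg (by simp) (by simp) h.closed).resolve_right fun hT => ?_
  obtain ⟨s, ⟨hs0, hs1⟩, t, ⟨ht0, ht1⟩, hst⟩ := h.exists_apply_arc_eq (u := 0) (v := 1) (a := 1)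
    (b := -1) (η := 1 / 2) (by simp) (by simp) h.closed (by norm_num) (by norm_num) (by simp [hT])
    (fun s hs => ⟨by linarith [hs.1], by linarith [hs.2]⟩)
    (fun s hs => ⟨by linarith [hs.2], by linarith [hs.1]⟩)
  have := h.simple ⟨by linarith, by linarith⟩ ⟨by linarith, by linarith⟩ hst
  linarith

lemma start_ne (h : IsThickCurve f T ℓ Δ) {w : ℝ} (hw : w ∈ Ioo (0 : ℝ) 1) : f 0 ≠ f w := by
  intro heq
  obtain ⟨b, hb, hT⟩ : ∃ b : ℝ, (b = 1 ∨ b = -1) ∧ (1 : ℝ) • T 0 = b • T w := by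
    rcases h.tangent_eq_or_eq_neg (by simp) ⟨hw.1.le, hw.2.le⟩ heq with hT | hT
    · exact ⟨1, .inl rfl, by rw [hT]⟩
    · exact ⟨-1, .inr rfl, by rw [hT, neg_one_smul, neg_neg, one_smul]⟩
  obtain ⟨η, hη, hη'⟩ := exists_between (lt_min hw.1 (sub_pos.2 hw.2))
  obtain ⟨hηw, hηw'⟩ := lt_min_iff.1 hη'
  have hw_mem : ∀ s ∈ Ioo 0 (η / 2), η / 2 < w + b * s ∧ w + b * s < 1 := by
    rintro s ⟨hs0, hs1⟩
    rcases hb with rfl | rfl <;> constructor <;> linarith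
  obtain ⟨s, ⟨hs0, hs1⟩, t, ht, hst⟩ := h.exists_apply_arc_eq (u := 0) (v := w) (η := η / 2)
    (by simp) ⟨hw.1.le, hw.2.le⟩ heq one_ne_zero (by linarith) hT
    (fun s hs => ⟨by linarith [hs.1], by linarith [hs.2, hw.2]⟩)
    (fun s hs => ⟨by linarith [hw_mem s hs], (hw_mem s hs).2.le⟩)
  have hwt := hw_mem t ht
  have := h.simple ⟨by linarith, by linarith⟩ ⟨by linarith, hwt.2⟩ hst
  linarith

lemma injOn_Ico (h : IsThickCurve f T ℓ Δ) : InjOn f (Ico 0 1) := by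
  intro u hu v hv huv
  rcases eq_or_lt_of_le hu.1 with rfl | hu0 <;> rcases eq_or_lt_of_le hv.1 with rfl | hv0
  · rfl
  · exact absurd huv (h.start_ne ⟨hv0, hv.2⟩)
  · exact absurd huv.symm (h.start_ne ⟨hu0, hu.2⟩)
  · exact h.simple ⟨hu0, hu.2⟩ ⟨hv0, hv.2⟩ huv

lemma eq_of_apply_eq (h : IsThickCurve f T ℓ Δ) (hu : u ∈ Icc (0 : ℝ) 1)
    (hv : v ∈ Icc (0 : ℝ) 1) (huv : f u = f v) :
    u = v ∨ (u = 0 ∧ v = 1) ∨ (u = 1 ∧ v = 0) := by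
  rcases eq_or_lt_of_le hu.2 with rfl | hu1 <;> rcases eq_or_lt_of_le hv.2 with rfl | hv1
  · exact .inl rfl
  · rw [← h.closed] at huv
    exact .inr (.inr ⟨rfl, (h.injOn_Ico (by simp) ⟨hv.1, hv1⟩ huv).symm⟩)
  · rw [← h.closed] at huv
    exact .inr (.inl ⟨h.injOn_Ico ⟨hu.1, hu1⟩ (by simp) huv, rfl⟩)
  · exact .inl (h.injOn_Ico ⟨hu.1, hu1⟩ ⟨hv.1, hv1⟩ huv)

lemma tangent_eq_of_apply_eq (h : IsThickCurve f T ℓ Δ) (hu : u ∈ Icc (0 : ℝ) 1)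
    (hv : v ∈ Icc (0 : ℝ) 1) (huv : f u = f v) : T u = T v := by
  rcases h.eq_of_apply_eq hu hv huv with rfl | ⟨rfl, rfl⟩ | ⟨rfl, rfl⟩
  · rfl
  · exact h.tangent_closed.symm
  · exact h.tangent_closed

/-- Both tangents make a small angle with the chord `f v - f u`, by `tangency` at its two ends. -/
lemma abs_cross_tangent_le (h : IsThickCurve f T ℓ Δ) (hu : u ∈ Icc (0 : ℝ) 1)
    (hv : v ∈ Icc (0 : ℝ) 1) : Δ * |cross (T u) (T v)| ≤ ‖f v - f u‖ := by
  by_cases hw : f v - f u = 0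
  · rw [h.cross_tangent_eq_zero hu hv (sub_eq_zero.1 hw).symm, hw]; simp
  set w := f v - f u with hwdef
  have hw0 : 0 < ‖w‖ := norm_pos_iff.2 hw
  have hΔ := h.thickness_pos
  have tangency_u : 2 * Δ * |cross (T u) w| ≤ ‖w‖ ^ 2 := h.tangency hu (mem_filament f hv)
  have tangency_v : 2 * Δ * |cross (T v) w| ≤ ‖w‖ ^ 2 := by
    have hrev : f u - f v = (-1 : ℝ) • w := by simp [hwdef]
    have := h.tangency hv (mem_filament f hu)
    rwa [hrev, cross_smul_right, abs_mul, norm_smul, abs_neg, abs_one, one_mul, norm_neg, norm_one,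
      one_mul] at this
  have inner_u : |inner ℝ (T u) w| ≤ ‖w‖ := by
    simpa [h.norm_tangent u hu] using abs_real_inner_le_norm (T u) w
  have inner_v : |inner ℝ (T v) w| ≤ ‖w‖ := by
    simpa [h.norm_tangent v hv] using abs_real_inner_le_norm (T v) w
  have hid : ‖w‖ ^ 2 * cross (T u) (T v) =
      cross (T u) w * inner ℝ (T v) w - inner ℝ (T u) w * cross (T v) w := by
    rw [plane_norm_sq, plane_inner, plane_inner, cross, cross, cross]; ring
  have hchord : ‖w‖ ^ 2 * |cross (T u) (T v)| ≤
      |cross (T u) w| * ‖w‖ + ‖w‖ * |cross (T v) w| := by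
    rw [← abs_of_pos (sq_pos_of_pos hw0), ← abs_mul, hid]
    refine (abs_sub _ _).trans ?_
    rw [abs_mul, abs_mul]
    gcongr
  refine le_of_mul_le_mul_left ?_ (sq_pos_of_pos hw0)
  calc ‖w‖ ^ 2 * (Δ * |cross (T u) (T v)|) = Δ * (‖w‖ ^ 2 * |cross (T u) (T v)|) := by ring
    _ ≤ Δ * (|cross (T u) w| * ‖w‖ + ‖w‖ * |cross (T v) w|) := by gcongr
    _ = (2 * Δ * |cross (T u) w| + 2 * Δ * |cross (T v) w|) * (‖w‖ / 2) := by ring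
    _ ≤ (‖w‖ ^ 2 + ‖w‖ ^ 2) * (‖w‖ / 2) := by gcongr
    _ = ‖w‖ ^ 2 * ‖w‖ := by ring

lemma inner_tangent_ne_zero (h : IsThickCurve f T ℓ Δ) (hu : u ∈ Icc (0 : ℝ) 1)
    (hv : v ∈ Icc (0 : ℝ) 1) (huv : ℓ * |v - u| < Δ) : inner ℝ (T u) (T v) ≠ 0 := by
  intro h0
  have habs := abs_cross_eq_of_inner_eq_zero h0
  rw [h.norm_tangent u hu, h.norm_tangent v hv] at habs
  have := (h.abs_cross_tangent_le hu hv).trans (h.norm_sub_le hu hv)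
  rw [habs] at this
  linarith

lemma inner_tangent_pos (h : IsThickCurve f T ℓ Δ) (hu : u ∈ Icc (0 : ℝ) 1)
    (hv : v ∈ Icc (0 : ℝ) 1) (huv : ℓ * |v - u| < Δ) : 0 < inner ℝ (T u) (T v) := by
  have hℓ := h.speed_pos
  set s : Set ℝ := Icc 0 1 ∩ closedBall u |v - u|
  have hs : Convex ℝ s := (convex_Icc 0 1).inter (convex_closedBall _ _)
  have hd : ∀ x ∈ s, HasDerivWithinAt (fun t => inner ℝ (T u) (f t))
      (inner ℝ (T u) (ℓ • T x)) s x := by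
    intro x hx
    simpa using (hasDerivWithinAt_const x s (T u)).inner ℝ
      ((h.hasDeriv x hx.1).mono inter_subset_left)
  have hne : ∀ x ∈ s, inner ℝ (T u) (ℓ • T x) ≠ 0 := by
    intro x hx
    have hxu : |x - u| ≤ |v - u| := by simpa [Real.dist_eq] using hx.2
    rw [inner_smul_right]
    exact mul_ne_zero hℓ.ne' (h.inner_tangent_ne_zero hu hx.1
      ((mul_le_mul_of_nonneg_left hxu hℓ.le).trans_lt huv))
  rcases hasDerivWithinAt_forall_lt_or_forall_gt_of_forall_ne hs hd hne with hneg | hpos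
  · have := hneg u ⟨hu, by simp⟩
    rw [inner_smul_right, real_inner_self_eq_norm_sq, h.norm_tangent u hu] at this
    linarith
  · have := hpos v ⟨hv, by simp [Real.dist_eq]⟩
    rw [inner_smul_right] at this
    exact (mul_pos_iff_of_pos_left hℓ).1 this

lemma norm_tangent_sub_le (h : IsThickCurve f T ℓ Δ) (hu : u ∈ Icc (0 : ℝ) 1)
    (hv : v ∈ Icc (0 : ℝ) 1) (huv : ℓ * |v - u| < Δ) :
    ‖T v - T u‖ ≤ 2 * (ℓ / Δ * |v - u|) := by
  have hΔ := h.thickness_pos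
  have inner_pos := h.inner_tangent_pos hu hv huv
  have norm_sq : ‖T v - T u‖ ^ 2 = 2 - 2 * inner ℝ (T u) (T v) := by
    rw [norm_sub_sq_real, h.norm_tangent u hu, h.norm_tangent v hv, real_inner_comm]; ring
  have pythagoras := inner_sq_add_cross_sq (T u) (T v)
  rw [h.norm_tangent u hu, h.norm_tangent v hv] at pythagoras
  have cross_le : |cross (T u) (T v)| ≤ ℓ / Δ * |v - u| := by
    rw [div_mul_eq_mul_div, le_div_iff₀' hΔ]
    exact (h.abs_cross_tangent_le hu hv).trans (h.norm_sub_le hu hv)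
  have norm_le : ‖T v - T u‖ ≤ 2 * |cross (T u) (T v)| := by
    rw [← sq_le_sq₀ (norm_nonneg _) (by positivity), mul_pow, sq_abs, norm_sq]
    nlinarith
  linarith

lemma continuousOn_tangent (h : IsThickCurve f T ℓ Δ) : ContinuousOn T (Icc 0 1) := by
  intro u hu
  have near : ∀ᶠ v in 𝓝[Icc 0 1] u, ℓ * |v - u| < Δ := by
    have : Continuous fun v : ℝ => ℓ * |v - u| := by fun_prop
    exact (this.continuousAt.eventually (gt_mem_nhds (by simpa using h.thickness_pos))).filter_mono
      nhdsWithin_le_nhds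
  have hle : ∀ᶠ v in 𝓝[Icc 0 1] u, ‖T v - T u‖ ≤ 2 * (ℓ / Δ * |v - u|) := by
    filter_upwards [near, self_mem_nhdsWithin] with v hv hvI
    exact h.norm_tangent_sub_le hu hvI hv
  have hzero : Tendsto (fun v => 2 * (ℓ / Δ * |v - u|)) (𝓝[Icc 0 1] u) (𝓝 0) := by
    have : Continuous fun v : ℝ => 2 * (ℓ / Δ * |v - u|) := by fun_prop
    simpa using (this.tendsto u).mono_left nhdsWithin_le_nhds
  exact tendsto_iff_norm_sub_tendsto_zero.2 (squeeze_zero' (by simp) hle hzero)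

end IsThickCurve

lemma sub_eq_sub_of_circleExp_eq {X : Type*} [TopologicalSpace X] {S : Set X}
    (hS : IsPreconnected S) {θ g : X → ℝ} (hθ : ContinuousOn θ S) (hg : ContinuousOn g S)
    (hexp : ∀ x ∈ S, Circle.exp (θ x) = Circle.exp (g x)) {a b : X} (ha : a ∈ S) (hb : b ∈ S) :
    θ a - g a = θ b - g b := by
  have hdiscrete : IsDiscrete (range ((↑) : ℤ → ℝ)) :=
    Int.isClosedEmbedding_coe_real.isInducing.isDiscrete_range
  have hinteger : MapsTo (fun x => (θ x - g x) / (2 * Real.pi)) S (range ((↑) : ℤ → ℝ)) := by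
    intro x hx
    obtain ⟨m, hm⟩ := Circle.exp_eq_exp.1 (hexp x hx)
    exact ⟨m, by simp only [hm]; field_simp; ring⟩
  have hconst := hS.constant_of_mapsTo hdiscrete ((hθ.sub hg).div_const _) hinteger ha hb
  exact (div_left_inj' Real.two_pi_pos.ne').1 hconst

section Unicoherence

variable {X : Type*} [TopologicalSpace X] [SimplyConnectedSpace X] [LocallyPathConnectedSpace X]
  {A B : Set X}

/-- The functions `exp (π i w)` on `A` and `exp (-π i w)` on `B` agree on `A ∩ B`. Their common
extension lifts to a real function `θ`, and following `θ` from `a` to `b` through `A` and through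
`B` gives the two different increments `π (w b - w a)` and `-π (w b - w a)`. -/
lemma eq_of_continuous_of_eq_zero_or_eq_one (hA : IsClosed A) (hB : IsClosed B)
    (hA' : IsPreconnected A) (hB' : IsPreconnected B) (hAB : A ∪ B = univ) {w : X → ℝ}
    (hw : Continuous w) (h01 : ∀ x ∈ A ∩ B, w x = 0 ∨ w x = 1) {a b : X} (ha : a ∈ A ∩ B)
    (hb : b ∈ A ∩ B) : w a = w b := by
  classical
  set F : X → Circle := fun x => if x ∈ A then Circle.exp (Real.pi * w x)
    else Circle.exp (-(Real.pi * w x)) with hF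
  have hFA : ∀ x ∈ A, F x = Circle.exp (Real.pi * w x) := fun x hx => by simp only [hF, if_pos hx]
  have hFB : ∀ x ∈ B, F x = Circle.exp (-(Real.pi * w x)) := by
    intro x hx
    by_cases hxA : x ∈ A
    · rw [hFA x hxA]
      rcases h01 x ⟨hxA, hx⟩ with h | h
      · simp [h]
      · rw [h, Circle.exp_eq_exp]; exact ⟨1, by push_cast; ring⟩
    · simp only [hF, if_neg hxA]
  have hFc : Continuous F := by
    rw [← continuousOn_univ, ← hAB]
    exact .union_of_isClosed (ContinuousOn.congr (by fun_prop) hFA)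
      (ContinuousOn.congr (by fun_prop) hFB) hA hB
  obtain ⟨θ₀, hθ₀⟩ := Circle.exp_surjective (F a)
  obtain ⟨θ, ⟨-, hθ⟩, -⟩ := Circle.isCoveringMap_exp.existsUnique_continuousMap_lifts
    (⟨F, hFc⟩ : C(X, Circle)) a θ₀ hθ₀
  have hθF : ∀ x, Circle.exp (θ x) = F x := congrFun hθ
  have along_A := sub_eq_sub_of_circleExp_eq hA' θ.continuous.continuousOn (by fun_prop)
    (fun x hx => (hθF x).trans (hFA x hx)) ha.1 hb.1
  have along_B := sub_eq_sub_of_circleExp_eq hB' θ.continuous.continuousOn (by fun_prop)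
    (fun x hx => (hθF x).trans (hFB x hx)) ha.2 hb.2
  exact mul_left_cancel₀ Real.pi_ne_zero (by linarith)

theorem isPreconnected_inter_of_union_eq_univ [NormalSpace X] (hA : IsClosed A) (hB : IsClosed B)
    (hA' : IsPreconnected A) (hB' : IsPreconnected B) (hAB : A ∪ B = univ) :
    IsPreconnected (A ∩ B) := by
  rw [isPreconnected_closed_iff]
  rintro s t hs ht hst ⟨a, ha, has⟩ ⟨b, hb, hbt⟩
  by_contra hne
  have hdisj : Disjoint (A ∩ B ∩ s) (A ∩ B ∩ t) :=
    disjoint_left.2 fun x hxs hxt => hne ⟨x, hxs.1, hxs.2, hxt.2⟩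
  obtain ⟨w, hw0, hw1, -⟩ := exists_continuous_zero_one_of_isClosed
    ((hA.inter hB).inter hs) ((hA.inter hB).inter ht) hdisj
  have hwa : w a = 0 := hw0 ⟨ha, has⟩
  have hwb : w b = 1 := hw1 ⟨hb, hbt⟩
  have hab := eq_of_continuous_of_eq_zero_or_eq_one hA hB hA' hB' hAB w.continuous
    (fun x hx => (hst hx).imp (fun h => hw0 ⟨hx, h⟩) fun h => hw1 ⟨hx, h⟩) ha hb
  linarith

end Unicoherence

/-- The points `x` reached from a closest point `f u` of the curve by moving in the direction
`N u`. -/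
def normalSide (f N : ℝ → Plane) : Set Plane :=
  {x | ∃ u ∈ Icc (0 : ℝ) 1, x = f u + infDist x (filament f) • N u}

section normalSide

variable {f N : ℝ → Plane}

lemma isClosed_normalSide (hf : ContinuousOn f (Icc 0 1)) (hN : ContinuousOn N (Icc 0 1)) :
    IsClosed (normalSide f N) := by
  have hf' : Continuous fun u : Icc (0 : ℝ) 1 => f u := continuousOn_iff_continuous_domRestrict.1 hf
  have hN' : Continuous fun u : Icc (0 : ℝ) 1 => N u := continuousOn_iff_continuous_domRestrict.1 hN
  have hd : Continuous fun x : Plane => infDist x (filament f) := continuous_infDist_pt _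
  have hcl : IsClosed {p : Icc (0 : ℝ) 1 × Plane |
      p.2 = f p.1 + infDist p.2 (filament f) • N p.1} :=
    isClosed_eq continuous_snd ((hf'.comp continuous_fst).add
      ((hd.comp continuous_snd).smul (hN'.comp continuous_fst)))
  convert isClosedMap_snd_of_compactSpace _ hcl using 1
  ext x
  constructor
  · rintro ⟨u, hu, hx⟩
    exact ⟨(⟨u, hu⟩, x), hx, rfl⟩
  · rintro ⟨⟨u, y⟩, hy, rfl⟩
    exact ⟨u, u.2, hy⟩

lemma filament_subset_normalSide : filament f ⊆ normalSide f N := by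
  rintro x ⟨u, hu, rfl⟩
  exact ⟨u, hu, by rw [infDist_zero_of_mem (mem_filament f hu), zero_smul, add_zero]⟩

lemma segment_subset_normalSide {u : ℝ} (hu : u ∈ Icc (0 : ℝ) 1) (hN : ‖N u‖ = 1) {d : ℝ}
    (hd : infDist (f u + d • N u) (filament f) = d) :
    (fun t => f u + t • N u) '' Icc 0 d ⊆ normalSide f N := by
  rintro _ ⟨t, ⟨ht0, htd⟩, rfl⟩
  have hle : infDist (f u + t • N u) (filament f) ≤ t := by
    refine (infDist_le_dist_of_mem (mem_filament f hu)).trans ?_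
    simp [norm_smul, hN, abs_of_nonneg ht0]
  have hge : d ≤ infDist (f u + t • N u) (filament f) + (d - t) := by
    calc d = infDist (f u + d • N u) (filament f) := hd.symm
      _ ≤ infDist (f u + t • N u) (filament f) + dist (f u + d • N u) (f u + t • N u) :=
          infDist_le_infDist_add_dist
      _ = _ := by
          rw [dist_add_left, dist_eq_norm, ← sub_smul, norm_smul, hN,
            Real.norm_of_nonneg (sub_nonneg.2 htd), mul_one]
  exact ⟨u, hu, by simp only [le_antisymm hle (by linarith)]⟩

lemma isPreconnected_normalSide (hf : ContinuousOn f (Icc 0 1))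
    (hN : ∀ u ∈ Icc (0 : ℝ) 1, ‖N u‖ = 1) : IsPreconnected (normalSide f N) := by
  refine isPreconnected_of_forall (f 0) ?_
  rintro y ⟨u, hu, hy⟩
  set d := infDist y (filament f)
  have hd0 : 0 ≤ d := infDist_nonneg
  have hseg : IsPreconnected ((fun t => f u + t • N u) '' Icc 0 d) :=
    isPreconnected_Icc.image _ (by fun_prop)
  have hΓ : IsPreconnected (filament f) := isPreconnected_Icc.image _ hf
  exact ⟨filament f ∪ (fun t => f u + t • N u) '' Icc 0 d,
    union_subset filament_subset_normalSide
      (segment_subset_normalSide hu (hN u hu) (by rw [← hy])),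
    .inl (mem_filament f (by simp)), .inr ⟨d, ⟨hd0, le_rfl⟩, hy.symm⟩,
    hΓ.union (f u) (mem_filament f hu) ⟨0, ⟨le_rfl, hd0⟩, by simp⟩ hseg⟩

end normalSide

lemma inner_deriv_nonpos_of_norm_le {E : Type*} [NormedAddCommGroup E] [InnerProductSpace ℝ E]
    {γ : ℝ → E} {v x : E} (hd : HasDerivWithinAt γ v (Ioi 0) 0)
    (hle : ∀ᶠ s in 𝓝[>] (0 : ℝ), ‖x - γ 0‖ ≤ ‖x - γ s‖) : inner ℝ (x - γ 0) v ≤ 0 := by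
  have hsq : HasDerivWithinAt (fun s => ‖x - γ s‖ ^ 2) (2 * inner ℝ (x - γ 0) (-v)) (Ioi 0) 0 :=
    (hd.const_sub x).norm_sq
  have hslope := (hasDerivWithinAt_iff_tendsto_slope' self_notMem_Ioi).1 hsq
  have hnonneg : 0 ≤ 2 * inner ℝ (x - γ 0) (-v) := by
    refine ge_of_tendsto hslope ?_
    filter_upwards [hle, self_mem_nhdsWithin] with s hs (hs0 : 0 < s)
    rw [slope_def_field]
    exact div_nonneg (sub_nonneg.2 (by gcongr)) (by linarith)
  rw [inner_neg_right] at hnonneg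
  linarith

lemma eq_cross_smul_rot_of_inner_eq_zero {p w : Plane} (hp : ‖p‖ = 1) (h0 : inner ℝ w p = 0) :
    w = cross p w • rot p := by
  have hnorm := plane_norm_sq p
  rw [hp] at hnorm
  rw [plane_inner] at h0
  apply plane_ext
  · simp only [cross, PiLp.smul_apply, rot_zero_apply, smul_eq_mul]
    linear_combination w 0 * hnorm + p 0 * h0
  · simp only [cross, PiLp.smul_apply, rot_one_apply, smul_eq_mul]
    linear_combination w 1 * hnorm + p 1 * h0

/-- The signed distance to the curve `f`, nonnegative on the side of the normal field `N`. -/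
noncomputable def curveSignedDist (f N : ℝ → Plane) (x : Plane) : ℝ :=
  open Classical in
  if x ∈ normalSide f N then infDist x (filament f) else -infDist x (filament f)

lemma curveSignedDist_of_mem {f N : ℝ → Plane} {x : Plane} (hx : x ∈ normalSide f N) :
    curveSignedDist f N x = infDist x (filament f) :=
  if_pos hx

/-- A closed curve `f` in the plane, with unit normal field `N` and signed distance `g`, that has a
tubular neighbourhood of radius `Δ`. -/
structure IsTube (f N : ℝ → Plane) (g : Plane → ℝ) (Δ : ℝ) : Prop where
  radius_pos : 0 < Δ
  continuousOn : ContinuousOn f (Icc 0 1)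
  continuousOn_normal : ContinuousOn N (Icc 0 1)
  closed : f 0 = f 1
  normal_closed : N 0 = N 1
  injOn : InjOn f (Ico 0 1)
  norm_normal : ∀ u ∈ Icc (0 : ℝ) 1, ‖N u‖ = 1
  abs_sub_le : ∀ x y, |g x - g y| ≤ dist x y
  apply_normal : ∀ u ∈ Icc (0 : ℝ) 1, ∀ t, |t| ≤ Δ → g (f u + t • N u) = t
  exists_eq : ∀ x, ∃ u ∈ Icc (0 : ℝ) 1, x = f u + g x • N u

namespace IsThickCurve

variable {f T : ℝ → Plane} {ℓ Δ : ℝ} {u v : ℝ} {x y : Plane}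

lemma mul_inner_tangent_nonpos (h : IsThickCurve f T ℓ Δ) (hu : u ∈ Icc (0 : ℝ) 1) {a η : ℝ}
    (hη : 0 < η) (hmem : ∀ s ∈ Ioo 0 η, u + a * s ∈ Icc (0 : ℝ) 1)
    (hx : ∀ c ∈ filament f, ‖x - f u‖ ≤ ‖x - c‖) : a * inner ℝ (x - f u) (T u) ≤ 0 := by
  have hderiv := inner_deriv_nonpos_of_norm_le (x := x) (h.hasDerivWithinAt_arc hu hη hmem) (by
    filter_upwards [Ioo_mem_nhdsGT hη] with s hs
    simpa using hx _ (mem_filament f (hmem s hs)))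
  rw [mul_zero, add_zero, inner_smul_right, inner_smul_right, mul_left_comm] at hderiv
  exact nonpos_of_mul_nonpos_right hderiv h.speed_pos

/-- The parameters `0` and `1` describe the same point, so a closest point is interior to the
parameter interval from the left and from the right. -/
lemma inner_tangent_eq_zero_of_closest (h : IsThickCurve f T ℓ Δ) (hu : u ∈ Icc (0 : ℝ) 1)
    (hx : ∀ c ∈ filament f, ‖x - f u‖ ≤ ‖x - c‖) : inner ℝ (x - f u) (T u) = 0 := by
  apply le_antisymm
  · obtain ⟨w, hw, hwu⟩ : ∃ w ∈ Ico (0 : ℝ) 1, f w = f u := by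
      rcases eq_or_lt_of_le hu.2 with rfl | hu1
      · exact ⟨0, by simp, h.closed⟩
      · exact ⟨u, ⟨hu.1, hu1⟩, rfl⟩
    have hwI := Ico_subset_Icc_self hw
    rw [← h.tangent_eq_of_apply_eq hwI hu hwu, ← hwu]
    simpa using h.mul_inner_tangent_nonpos (a := 1) hwI (sub_pos.2 hw.2)
      (fun s hs => ⟨by linarith [hs.1, hw.1], by linarith [hs.2]⟩) (by rwa [hwu])
  · obtain ⟨w, hw, hwu⟩ : ∃ w ∈ Ioc (0 : ℝ) 1, f w = f u := by
      rcases eq_or_lt_of_le hu.1 with rfl | hu0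
      · exact ⟨1, by simp, h.closed.symm⟩
      · exact ⟨u, ⟨hu0, hu.2⟩, rfl⟩
    have hwI := Ioc_subset_Icc_self hw
    rw [← h.tangent_eq_of_apply_eq hwI hu hwu, ← hwu]
    simpa using h.mul_inner_tangent_nonpos (a := -1) hwI hw.1
      (fun s hs => ⟨by linarith [hs.2], by linarith [hs.1, hw.2]⟩) (by rwa [hwu])

lemma norm_normal (h : IsThickCurve f T ℓ Δ) (hu : u ∈ Icc (0 : ℝ) 1) : ‖rot (T u)‖ = 1 := by
  rw [norm_rot, h.norm_tangent u hu]

lemma continuousOn_normal (h : IsThickCurve f T ℓ Δ) :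
    ContinuousOn (fun u => rot (T u)) (Icc 0 1) :=
  continuous_rot.comp_continuousOn h.continuousOn_tangent

lemma le_norm_normal_sub_sq (h : IsThickCurve f T ℓ Δ) (hu : u ∈ Icc (0 : ℝ) 1) {c : Plane}
    (hc : c ∈ filament f) (t : ℝ) :
    Δ * t ^ 2 + (Δ - |t|) * ‖c - f u‖ ^ 2 ≤ Δ * ‖f u + t • rot (T u) - c‖ ^ 2 := by
  have expand : ‖f u + t • rot (T u) - c‖ ^ 2 =
      t ^ 2 - 2 * (t * cross (T u) (c - f u)) + ‖c - f u‖ ^ 2 := by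
    rw [show f u + t • rot (T u) - c = t • rot (T u) - (c - f u) by abel, norm_sub_sq_real,
      real_inner_smul_left, inner_rot, norm_smul, h.norm_normal hu, mul_one, Real.norm_eq_abs,
      sq_abs]
  have htangency := mul_le_mul_of_nonneg_left (h.tangency hu hc) (abs_nonneg t)
  have habs : Δ * (t * cross (T u) (c - f u)) ≤ Δ * (|t| * |cross (T u) (c - f u)|) := by
    rw [← abs_mul]
    exact mul_le_mul_of_nonneg_left (le_abs_self _) h.thickness_pos.le
  rw [expand]
  linarith

lemma infDist_add_smul_normal (h : IsThickCurve f T ℓ Δ) (hu : u ∈ Icc (0 : ℝ) 1) {t : ℝ}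
    (ht : |t| ≤ Δ) : infDist (f u + t • rot (T u)) (filament f) = |t| := by
  apply le_antisymm
  · refine (infDist_le_dist_of_mem (mem_filament f hu)).trans ?_
    simp [norm_smul, h.norm_normal hu]
  · refine (le_infDist (filament_nonempty f)).2 fun c hc => ?_
    have hsq := h.le_norm_normal_sub_sq hu hc t
    have : 0 ≤ (Δ - |t|) * ‖c - f u‖ ^ 2 := mul_nonneg (sub_nonneg.2 ht) (by positivity)
    rw [dist_eq_norm]
    exact abs_le_of_sq_le_sq (le_of_mul_le_mul_left (by linarith) h.thickness_pos) (norm_nonneg _)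

lemma mem_normalSide_or (h : IsThickCurve f T ℓ Δ) (x : Plane) :
    x ∈ normalSide f (fun u => rot (T u)) ∨ x ∈ normalSide f (fun u => -rot (T u)) := by
  obtain ⟨_, ⟨u, hu, rfl⟩, hclosest⟩ :=
    (isCompact_filament h.continuousOn).exists_infDist_eq_dist (filament_nonempty f) x
  have hinner : inner ℝ (x - f u) (T u) = 0 := h.inner_tangent_eq_zero_of_closest hu fun c hc => by
    rw [← dist_eq_norm, ← dist_eq_norm, ← hclosest]
    exact infDist_le_dist_of_mem hc
  have hd : infDist x (filament f) = |cross (T u) (x - f u)| := by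
    rw [hclosest, dist_eq_norm, abs_cross_eq_of_inner_eq_zero (by rwa [real_inner_comm]),
      h.norm_tangent u hu, one_mul]
  have hx : x = f u + cross (T u) (x - f u) • rot (T u) := by
    rw [← eq_cross_smul_rot_of_inner_eq_zero (h.norm_tangent u hu) hinner, add_sub_cancel]
  rcases abs_choice (cross (T u) (x - f u)) with hc | hc
  · exact .inl ⟨u, hu, by rwa [hd, hc]⟩
  · exact .inr ⟨u, hu, by rwa [hd, hc, neg_smul_neg]⟩

lemma infDist_eq_zero_of_mem_inter (h : IsThickCurve f T ℓ Δ)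
    (hx : x ∈ normalSide f (fun u => rot (T u)) ∩ normalSide f (fun u => -rot (T u)))
    (hlt : infDist x (filament f) < Δ) : infDist x (filament f) = 0 := by
  obtain ⟨⟨u, hu, hxu⟩, v, hv, hxv⟩ := hx
  set d := infDist x (filament f)
  have hd : 0 ≤ d := infDist_nonneg
  have hfoot : f v = f u := by
    have hsq := h.le_norm_normal_sub_sq hu (mem_filament f hv) d
    have hdist : ‖x - f v‖ = d := by
      rw [hxv, add_sub_cancel_left, norm_smul, norm_neg, h.norm_normal hv,
        Real.norm_of_nonneg hd, mul_one]
    rw [← hxu, hdist, abs_of_nonneg hd] at hsq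
    have hle : ‖f v - f u‖ ^ 2 ≤ 0 :=
      nonpos_of_mul_nonpos_right (by linarith) (sub_pos.2 hlt)
    simpa [sub_eq_zero] using le_antisymm hle (by positivity)
  have hnormal : d • rot (T u) = d • -rot (T u) := by
    simp only [hfoot, h.tangent_eq_of_apply_eq hv hu hfoot] at hxv
    exact add_left_cancel (hxu.symm.trans hxv)
  have hinner := congrArg (inner ℝ (rot (T u))) hnormal
  rw [inner_smul_right, inner_smul_right, inner_neg_right, real_inner_self_eq_norm_sq,
    h.norm_normal hu] at hinner
  linarith

/-- The intersection of the two sides is connected and contains the curve, while its points are at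
distance `0` or at least `Δ` from the curve. -/
lemma normalSide_inter (h : IsThickCurve f T ℓ Δ) :
    normalSide f (fun u => rot (T u)) ∩ normalSide f (fun u => -rot (T u)) = filament f := by
  refine Subset.antisymm (fun x hx => ?_)
    (subset_inter filament_subset_normalSide filament_subset_normalSide)
  set A := normalSide f fun u => rot (T u)
  set B := normalSide f fun u => -rot (T u)
  have hconn : IsPreconnected (A ∩ B) := isPreconnected_inter_of_union_eq_univ
    (isClosed_normalSide h.continuousOn h.continuousOn_normal)
    (isClosed_normalSide h.continuousOn h.continuousOn_normal.neg)
    (isPreconnected_normalSide h.continuousOn fun u hu => h.norm_normal hu)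
    (isPreconnected_normalSide h.continuousOn fun u hu => by rw [norm_neg, h.norm_normal hu])
    (eq_univ_of_forall h.mem_normalSide_or)
  have h0Γ : f 0 ∈ filament f := mem_filament f (by simp)
  have hΔ := h.thickness_pos
  have hlt : infDist x (filament f) < Δ := by
    by_contra! hle
    obtain ⟨y, hy, hyd⟩ := hconn.intermediate_value
      ⟨filament_subset_normalSide h0Γ, filament_subset_normalSide h0Γ⟩ hx
      (continuous_infDist_pt (filament f)).continuousOn
      (show Δ / 2 ∈ Icc _ _ from ⟨by rw [infDist_zero_of_mem h0Γ]; linarith, by linarith⟩)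
    have := h.infDist_eq_zero_of_mem_inter hy (by linarith)
    linarith
  exact ((isCompact_filament h.continuousOn).isClosed.mem_iff_infDist_zero
    (filament_nonempty f)).2 (h.infDist_eq_zero_of_mem_inter hx hlt)

lemma curveSignedDist_of_mem_neg (h : IsThickCurve f T ℓ Δ)
    (hx : x ∈ normalSide f (fun u => -rot (T u))) :
    curveSignedDist f (fun u => rot (T u)) x = -infDist x (filament f) := by
  by_cases hxA : x ∈ normalSide f fun u => rot (T u)
  · have hxΓ : x ∈ filament f := h.normalSide_inter ▸ ⟨hxA, hx⟩
    rw [curveSignedDist_of_mem hxA, infDist_zero_of_mem hxΓ, neg_zero]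
  · exact if_neg hxA

/-- The segment between points on opposite sides meets the curve. -/
lemma infDist_add_infDist_le_dist (h : IsThickCurve f T ℓ Δ)
    (hx : x ∈ normalSide f (fun u => rot (T u))) (hy : y ∈ normalSide f (fun u => -rot (T u))) :
    infDist x (filament f) + infDist y (filament f) ≤ dist x y := by
  obtain ⟨w, hw, hwAB⟩ := isPreconnected_closed_iff.1 (convex_segment x y).isPreconnected
    (normalSide f fun u => rot (T u)) (normalSide f fun u => -rot (T u))
    (isClosed_normalSide h.continuousOn h.continuousOn_normal)
    (isClosed_normalSide h.continuousOn h.continuousOn_normal.neg)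
    (fun z _ => h.mem_normalSide_or z) ⟨x, left_mem_segment ℝ x y, hx⟩
    ⟨y, right_mem_segment ℝ x y, hy⟩
  rw [h.normalSide_inter] at hwAB
  rw [← dist_add_dist_of_mem_segment hw, dist_comm w y]
  exact add_le_add (infDist_le_dist_of_mem hwAB) (infDist_le_dist_of_mem hwAB)

lemma abs_curveSignedDist_sub_le (h : IsThickCurve f T ℓ Δ) (x y : Plane) :
    |curveSignedDist f (fun u => rot (T u)) x - curveSignedDist f (fun u => rot (T u)) y| ≤
      dist x y := by
  have same_side : ∀ x y : Plane, |infDist x (filament f) - infDist y (filament f)| ≤ dist x y :=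
    fun x y => by simpa [Real.dist_eq] using (lipschitz_infDist_pt (filament f)).dist_le_mul x y
  have hnonneg : ∀ x y : Plane, 0 ≤ infDist x (filament f) + infDist y (filament f) :=
    fun x y => add_nonneg infDist_nonneg infDist_nonneg
  rcases h.mem_normalSide_or x with hx | hx <;> rcases h.mem_normalSide_or y with hy | hy
  · rw [curveSignedDist_of_mem hx, curveSignedDist_of_mem hy]
    exact same_side x y
  · rw [curveSignedDist_of_mem hx, h.curveSignedDist_of_mem_neg hy, sub_neg_eq_add,
      abs_of_nonneg (hnonneg x y)]
    exact h.infDist_add_infDist_le_dist hx hy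
  · rw [h.curveSignedDist_of_mem_neg hx, curveSignedDist_of_mem hy, ← neg_add', abs_neg,
      abs_of_nonneg (hnonneg x y), add_comm, dist_comm]
    exact h.infDist_add_infDist_le_dist hy hx
  · rw [h.curveSignedDist_of_mem_neg hx, h.curveSignedDist_of_mem_neg hy, neg_sub_neg,
      abs_sub_comm]
    exact same_side x y

lemma curveSignedDist_add_smul_normal (h : IsThickCurve f T ℓ Δ) (hu : u ∈ Icc (0 : ℝ) 1) {t : ℝ}
    (ht : |t| ≤ Δ) : curveSignedDist f (fun u => rot (T u)) (f u + t • rot (T u)) = t := by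
  have hd := h.infDist_add_smul_normal hu ht
  rcases le_total 0 t with h0 | h0
  · rw [abs_of_nonneg h0] at hd
    rw [curveSignedDist_of_mem ⟨u, hu, by rw [hd]⟩, hd]
  · rw [abs_of_nonpos h0] at hd
    rw [h.curveSignedDist_of_mem_neg ⟨u, hu, by rw [hd, neg_smul_neg]⟩, hd, neg_neg]

lemma exists_eq_add_curveSignedDist_smul (h : IsThickCurve f T ℓ Δ) (x : Plane) :
    ∃ u ∈ Icc (0 : ℝ) 1, x = f u + curveSignedDist f (fun u => rot (T u)) x • rot (T u) := by
  rcases h.mem_normalSide_or x with hx | hx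
  · rw [curveSignedDist_of_mem hx]
    exact hx
  · obtain ⟨u, hu, hxu⟩ := hx
    exact ⟨u, hu, by rwa [h.curveSignedDist_of_mem_neg ⟨u, hu, hxu⟩, neg_smul, ← smul_neg]⟩

theorem isTube (h : IsThickCurve f T ℓ Δ) :
    IsTube f (fun u => rot (T u)) (curveSignedDist f fun u => rot (T u)) Δ where
  radius_pos := h.thickness_pos
  continuousOn := h.continuousOn
  continuousOn_normal := h.continuousOn_normal
  closed := h.closed
  normal_closed := by rw [h.tangent_closed]
  injOn := h.injOn_Ico
  norm_normal _ hu := h.norm_normal hu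
  abs_sub_le := h.abs_curveSignedDist_sub_le
  apply_normal _ hu _ ht := h.curveSignedDist_add_smul_normal hu ht
  exists_eq := h.exists_eq_add_curveSignedDist_smul

end IsThickCurve

lemma exists_dist_le_hausdorffDist {X : Type*} [PseudoMetricSpace X] {A B : Set X}
    (hA : Bornology.IsBounded A) (hB : IsCompact B) (hB' : B.Nonempty) {x : X} (hx : x ∈ A) :
    ∃ y ∈ B, dist x y ≤ hausdorffDist A B := by
  obtain ⟨y, hy, hxy⟩ := hB.exists_infDist_eq_dist hB' x
  exact ⟨y, hy, hxy ▸ infDist_le_hausdorffDist_of_mem hx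
    (hausdorffEDist_ne_top_of_nonempty_of_bounded ⟨x, hx⟩ hB' hA hB.isBounded)⟩

/-- The parallel curve at signed distance `t` from the curve `f` with normal field `N`. -/
def offsetCurve (f N : ℝ → Plane) (t : ℝ) : Set Plane :=
  (fun u => f u + t • N u) '' Icc 0 1

lemma mem_offsetCurve (f N : ℝ → Plane) (t : ℝ) {u : ℝ} (hu : u ∈ Icc (0 : ℝ) 1) :
    f u + t • N u ∈ offsetCurve f N t :=
  mem_image_of_mem _ hu

lemma offsetCurve_nonempty (f N : ℝ → Plane) (t : ℝ) : (offsetCurve f N t).Nonempty :=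
  ⟨_, mem_offsetCurve f N t (by simp : (0 : ℝ) ∈ Icc 0 1)⟩

lemma offsetCurve_zero (f N : ℝ → Plane) : offsetCurve f N 0 = filament f := by
  simp [offsetCurve, filament]

lemma offsetCurve_neg_normal (f N : ℝ → Plane) (t : ℝ) :
    offsetCurve f (fun u => -N u) t = offsetCurve f N (-t) := by
  simp only [offsetCurve, smul_neg, neg_smul]

namespace IsTube

variable {f N : ℝ → Plane} {g : Plane → ℝ} {Δ σ ε t u : ℝ} {x y z : Plane}

lemma neg (h : IsTube f N g Δ) : IsTube f (fun u => -N u) (fun x => -g x) Δ where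
  __ := h
  continuousOn_normal := h.continuousOn_normal.neg
  normal_closed := congrArg Neg.neg h.normal_closed
  norm_normal u hu := by rw [norm_neg, h.norm_normal u hu]
  abs_sub_le x y := by rw [neg_sub_neg, abs_sub_comm]; exact h.abs_sub_le x y
  apply_normal u hu t ht := by
    rw [smul_neg, ← neg_smul, h.apply_normal u hu (-t) (by rwa [abs_neg]), neg_neg]
  exists_eq x := by simpa only [neg_smul_neg] using h.exists_eq x

lemma sign (h : IsTube f N g Δ) {s : ℝ} (hs : s = 1 ∨ s = -1) :
    IsTube f (fun u => s • N u) (fun x => s * g x) Δ := by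
  rcases hs with rfl | rfl
  · simpa using h
  · simpa using h.neg

lemma continuous_signedDist (h : IsTube f N g Δ) : Continuous g :=
  (LipschitzWith.of_dist_le_mul (K := 1) fun x y => by
    simpa [Real.dist_eq] using h.abs_sub_le x y).continuous

lemma continuousOn_offset (h : IsTube f N g Δ) (t : ℝ) :
    ContinuousOn (fun u => f u + t • N u) (Icc 0 1) :=
  h.continuousOn.add (h.continuousOn_normal.const_smul t)

lemma isCompact_offsetCurve (h : IsTube f N g Δ) (t : ℝ) : IsCompact (offsetCurve f N t) :=
  isCompact_Icc.image_of_continuousOn (h.continuousOn_offset t)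

lemma dist_offset (h : IsTube f N g Δ) (hu : u ∈ Icc (0 : ℝ) 1) (s t : ℝ) :
    dist (f u + s • N u) (f u + t • N u) = |s - t| := by
  rw [dist_add_left, dist_eq_norm, ← sub_smul, norm_smul, h.norm_normal u hu, mul_one,
    Real.norm_eq_abs]

lemma exists_dist_offset_eq (h : IsTube f N g Δ) (x : Plane) :
    ∃ u ∈ Icc (0 : ℝ) 1, ∀ t, dist x (f u + t • N u) = |g x - t| := by
  obtain ⟨u, hu, hx⟩ := h.exists_eq x
  exact ⟨u, hu, fun t => by rw [← h.dist_offset hu, ← hx]⟩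

lemma infDist_offsetCurve (h : IsTube f N g Δ) (ht : |t| ≤ Δ) (x : Plane) :
    infDist x (offsetCurve f N t) = |g x - t| := by
  apply le_antisymm
  · obtain ⟨u, hu, hx⟩ := h.exists_dist_offset_eq x
    exact (infDist_le_dist_of_mem (mem_offsetCurve f N t hu)).trans_eq (hx t)
  · refine (le_infDist (offsetCurve_nonempty f N t)).2 ?_
    rintro _ ⟨u, hu, rfl⟩
    simpa only [h.apply_normal u hu t ht] using h.abs_sub_le x (f u + t • N u)

lemma infDist_filament (h : IsTube f N g Δ) (x : Plane) : infDist x (filament f) = |g x| := by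
  simpa only [offsetCurve_zero, sub_zero] using
    h.infDist_offsetCurve (t := 0) (by simpa using h.radius_pos.le) x

lemma abs_signedDist_sub_le_of_mem (h : IsTube f N g Δ) {A : Set Plane}
    (hA : Bornology.IsBounded A) (ht : |t| ≤ Δ) (hε : hausdorffDist (offsetCurve f N t) A ≤ ε)
    (hx : x ∈ A) : |g x - t| ≤ ε := by
  rw [← h.infDist_offsetCurve ht]
  refine (infDist_le_hausdorffDist_of_mem hx (hausdorffEDist_ne_top_of_nonempty_of_bounded ⟨x, hx⟩
    (offsetCurve_nonempty f N t) hA (h.isCompact_offsetCurve t).isBounded)).trans ?_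
  rwa [hausdorffDist_comm]

lemma infDist_offsetCurve_le_iff (h : IsTube f N g Δ) (hσ : 0 < σ) (hσΔ : σ ≤ Δ) (x : Plane) :
    infDist x (offsetCurve f N σ) ≤ infDist x (offsetCurve f N (-σ)) ↔ 0 ≤ g x := by
  have hσ' : |σ| ≤ Δ := by rwa [abs_of_pos hσ]
  rw [h.infDist_offsetCurve hσ', h.infDist_offsetCurve (by rwa [abs_neg]), ← sq_le_sq]
  constructor <;> intro h1 <;> nlinarith

/-- The disc of radius `Δ - g y` around `f u + Δ • N u` does not contain `y` in its interior. -/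
lemma mul_inner_normal_le (h : IsTube f N g Δ) (hu : u ∈ Icc (0 : ℝ) 1) (t : ℝ) (hy : g y ≤ Δ) :
    2 * (Δ - t) * inner ℝ (N u) (y - (f u + t • N u)) ≤
      ‖y - (f u + t • N u)‖ ^ 2 + (Δ - t) ^ 2 - (Δ - g y) ^ 2 := by
  have houtside := (le_abs_self _).trans (h.abs_sub_le (f u + Δ • N u) y)
  rw [h.apply_normal u hu Δ (abs_of_pos h.radius_pos).le, dist_comm, dist_eq_norm,
    show y - (f u + Δ • N u) = y - (f u + t • N u) - (Δ - t) • N u by rw [sub_smul]; abel]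
    at houtside
  have hsq := pow_le_pow_left₀ (sub_nonneg.2 hy) houtside 2
  rw [norm_sub_sq_real, inner_smul_right, norm_smul, h.norm_normal u hu, mul_one,
    Real.norm_eq_abs, sq_abs, real_inner_comm] at hsq
  linarith

lemma eq_of_offset_eq (h : IsTube f N g Δ) {v : ℝ} (ht : 0 ≤ t) (htΔ : t < Δ)
    (hu : u ∈ Icc (0 : ℝ) 1) (hv : v ∈ Icc (0 : ℝ) 1) (huv : f u + t • N u = f v + t • N v) :
    f u = f v := by
  have hgv : g (f v) = 0 := by
    simpa using h.apply_normal v hv 0 (by simpa using h.radius_pos.le)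
  have htangency := h.mul_inner_normal_le hu 0 (hgv.trans_le h.radius_pos.le)
  rw [hgv, zero_smul, add_zero] at htangency
  have hchord : ‖f v - f u‖ ^ 2 = 2 * t * inner ℝ (N u) (f v - f u) := by
    have hsq : ‖t • N u - (f v - f u)‖ ^ 2 = t ^ 2 := by
      rw [show t • N u - (f v - f u) = f u + t • N u - f v by abel, huv, add_sub_cancel_left,
        norm_smul, h.norm_normal v hv, mul_one, Real.norm_eq_abs, sq_abs]
    rw [norm_sub_sq_real, real_inner_smul_left, norm_smul, h.norm_normal u hu, mul_one,
      Real.norm_eq_abs, sq_abs] at hsq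
    linarith
  have hzero : (Δ - t) * ‖f v - f u‖ ^ 2 ≤ 0 := by
    have := mul_le_mul_of_nonneg_left htangency ht
    linear_combination this + Δ * hchord
  have hnorm : ‖f v - f u‖ ^ 2 = 0 :=
    le_antisymm (nonpos_of_mul_nonpos_right hzero (sub_pos.2 htΔ)) (by positivity)
  exact (sub_eq_zero.1 (by simpa using hnorm)).symm

end IsTube

/-- The constant of the `√ε` bound for the medial estimator: `2ε ≤ 2√Δ √ε`, and the second summand
comes from `IsTube.dist_antipode_le`. -/
noncomputable def medialConst (σ Δ : ℝ) : ℝ := 2 * √Δ + √(16 * Δ * (Δ + σ) / (Δ - σ))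

lemma medialConst_pos {σ Δ : ℝ} (hΔ : 0 < Δ) : 0 < medialConst σ Δ := by
  unfold medialConst; positivity

lemma two_mul_le_medialConst_mul_sqrt {σ Δ ε : ℝ} (hε : 0 ≤ ε) (hεΔ : ε ≤ Δ) :
    2 * ε ≤ medialConst σ Δ * √ε := by
  calc 2 * ε = 2 * √ε * √ε := by rw [mul_assoc, Real.mul_self_sqrt hε]
    _ ≤ medialConst σ Δ * √ε := by
      have : 0 ≤ √(16 * Δ * (Δ + σ) / (Δ - σ)) := Real.sqrt_nonneg _
      rw [medialConst]
      gcongr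
      linarith [Real.sqrt_le_sqrt hεΔ]

namespace IsTube

variable {f N : ℝ → Plane} {g : Plane → ℝ} {Δ σ ε u : ℝ} {y z : Plane}

/-- The disc of radius `2σ` around `f u + σ • N u` lies in the disc of radius `Δ + σ` around
`f u + Δ • N u`, whose interior avoids `g ≤ -σ`, and touches its boundary only at the antipode
`f u - σ • N u`. -/
lemma dist_antipode_le (h : IsTube f N g Δ) (hσ : 0 < σ) (hε : 0 ≤ ε) (hεΔ : ε ≤ (Δ - σ) / 2)
    (hσΔ : σ < Δ) (hu : u ∈ Icc (0 : ℝ) 1) (hz : g z ≤ -σ + ε)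
    (hd : dist z (f u + σ • N u) ≤ 2 * σ + 3 * ε) :
    dist z (f u - σ • N u) ≤ √(16 * Δ * (Δ + σ) / (Δ - σ)) * √ε := by
  have hbelow := h.mul_inner_normal_le hu σ (y := z) (by linarith)
  have hdecomp : z - (f u - σ • N u) = z - (f u + σ • N u) + (2 * σ) • N u := by
    rw [two_mul, add_smul]; abel
  rw [dist_eq_norm] at hd
  rw [dist_eq_norm, hdecomp]
  set ξ := z - (f u + σ • N u)
  rw [← Real.sqrt_mul' _ hε]
  apply Real.le_sqrt_of_sq_le
  rw [div_mul_eq_mul_div, le_div_iff₀ (sub_pos.2 hσΔ), norm_add_sq_real, inner_smul_right,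
    norm_smul, h.norm_normal u hu, mul_one, Real.norm_eq_abs, sq_abs, real_inner_comm]
  have hξ : ‖ξ‖ ^ 2 ≤ (2 * σ + 3 * ε) ^ 2 := by gcongr
  have hgz : (Δ + σ - ε) ^ 2 ≤ (Δ - g z) ^ 2 := by gcongr ?_ ^ 2 <;> linarith
  have hεε : ε * ε ≤ (Δ - σ) / 2 * ε := by gcongr
  have := h.radius_pos
  nlinarith [mul_le_mul_of_nonneg_left hξ (by linarith : 0 ≤ Δ + σ),
    mul_le_mul_of_nonneg_left hgz hσ.le, mul_le_mul_of_nonneg_left hbelow hσ.le,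
    mul_le_mul_of_nonneg_left hεε (by linarith : 0 ≤ Δ + σ), mul_nonneg hσ.le (sq_nonneg ε)]

lemma dist_midpoint_le (h : IsTube f N g Δ) (hσ : 0 < σ) (hεΔ : ε ≤ (Δ - σ) / 2) (hσΔ : σ < Δ)
    (hu : u ∈ Icc (0 : ℝ) 1) (hy : dist y (f u + σ • N u) ≤ ε) (hz : g z ≤ -σ + ε)
    (hyz : dist y z ≤ 2 * σ + 2 * ε) : dist (midpoint ℝ y z) (f u) ≤ medialConst σ Δ * √ε := by
  have hε : 0 ≤ ε := dist_nonneg.trans hy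
  have hantipode := h.dist_antipode_le hσ hε hεΔ hσΔ hu hz
    (by linarith [dist_triangle_left z (f u + σ • N u) y])
  have hε' := two_mul_le_medialConst_mul_sqrt (σ := σ) hε (by linarith : ε ≤ Δ)
  have hconst : √(16 * Δ * (Δ + σ) / (Δ - σ)) * √ε ≤ medialConst σ Δ * √ε := by
    rw [medialConst]
    gcongr
    linarith [Real.sqrt_nonneg Δ]
  calc dist (midpoint ℝ y z) (f u)
      = dist (midpoint ℝ y z) (midpoint ℝ (f u + σ • N u) (f u - σ • N u)) := by
        rw [midpoint_add_sub]
    _ ≤ (dist y (f u + σ • N u) + dist z (f u - σ • N u)) / 2 :=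
        (dist_midpoint_midpoint_le' y z _ _).trans_eq (by norm_num)
    _ ≤ medialConst σ Δ * √ε := by linarith

lemma abs_signedDist_midpoint_le (h : IsTube f N g Δ) (hy : |g y - σ| ≤ ε) (hz : |g z - -σ| ≤ ε)
    (hyz : dist y z ≤ 2 * σ + 2 * ε) : |g (midpoint ℝ y z)| ≤ 2 * ε := by
  have hmy := h.abs_sub_le (midpoint ℝ y z) y
  have hmz := h.abs_sub_le (midpoint ℝ y z) z
  rw [dist_midpoint_left, Real.norm_ofNat] at hmy
  rw [dist_midpoint_right, Real.norm_ofNat] at hmz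
  rw [abs_le] at *
  constructor <;> linarith

lemma infDist_opposite_le (h : IsTube f N g Δ) (hσ : 0 ≤ σ) {A : Set Plane} (hA : IsCompact A)
    (hA' : A.Nonempty) (hε : hausdorffDist (offsetCurve f N (-σ)) A ≤ ε)
    (hu : u ∈ Icc (0 : ℝ) 1) (hy : dist y (f u + σ • N u) ≤ ε) :
    infDist y A ≤ 2 * σ + 2 * ε := by
  obtain ⟨w, hw, hdist⟩ := exists_dist_le_hausdorffDist
    (h.isCompact_offsetCurve (-σ)).isBounded hA hA' (mem_offsetCurve f N (-σ) hu)
  have hdiam := h.dist_offset hu σ (-σ)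
  rw [abs_of_nonneg (by linarith)] at hdiam
  linarith [infDist_le_dist_of_mem (x := y) hw,
    dist_triangle4 y (f u + σ • N u) (f u + (-σ) • N u) w]

theorem medial_bound (h : IsTube f N g Δ) (hσ : 0 < σ) (hσΔ : σ < Δ) {A₀ A₁ Γhat : Set Plane}
    (hA₀ : IsCompact A₀) (hA₀' : A₀.Nonempty) (hA₁ : IsCompact A₁) (hA₁' : A₁.Nonempty)
    (h₀ : hausdorffDist (offsetCurve f N σ) A₀ ≤ ε)
    (h₁ : hausdorffDist (offsetCurve f N (-σ)) A₁ ≤ ε) (hε : ε < (Δ - σ) / 2)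
    (hm : IsMedialEstimator A₀ A₁ Γhat) :
    (∀ m ∈ Γhat, ∃ x ∈ filament f, ‖m - x‖ ≤ 2 * ε) ∧
    (∀ x ∈ filament f, ∃ m ∈ Γhat, ‖m - x‖ ≤ medialConst σ Δ * √ε) ∧
    hausdorffDist Γhat (filament f) ≤ medialConst σ Δ * √ε := by
  have hε0 : 0 ≤ ε := hausdorffDist_nonneg.trans h₀
  have hσ' : |σ| ≤ Δ := by rw [abs_of_pos hσ]; exact hσΔ.le
  obtain ⟨p, hp, rfl⟩ := hm
  have level₀ : ∀ y ∈ A₀, |g y - σ| ≤ ε := fun y =>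
    h.abs_signedDist_sub_le_of_mem hA₀.isBounded hσ' h₀
  have level₁ : ∀ y ∈ A₀, |g (p y) - -σ| ≤ ε := fun y hy =>
    h.abs_signedDist_sub_le_of_mem hA₁.isBounded (by rwa [abs_neg]) h₁ (hp y hy).1
  have width : ∀ y ∈ A₀, dist y (p y) ≤ 2 * σ + 2 * ε := fun y hy => by
    obtain ⟨u, hu, hyu⟩ := h.exists_dist_offset_eq y
    rw [(hp y hy).2]
    exact h.infDist_opposite_le hσ.le hA₁ hA₁' h₁ hu ((hyu σ).trans_le (level₀ y hy))
  have near_curve : ∀ m ∈ (fun y => midpoint ℝ y (p y)) '' A₀,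
      ∃ x ∈ filament f, dist m x ≤ 2 * ε := by
    rintro _ ⟨y, hy, rfl⟩
    obtain ⟨u, hu, hmu⟩ := h.exists_dist_offset_eq (midpoint ℝ y (p y))
    have hm := h.abs_signedDist_midpoint_le (level₀ y hy) (level₁ y hy) (width y hy)
    exact ⟨f u, mem_filament f hu, by simpa using (hmu 0).trans_le (by rwa [sub_zero])⟩
  have curve_near : ∀ x ∈ filament f, ∃ m ∈ (fun y => midpoint ℝ y (p y)) '' A₀,
      dist m x ≤ medialConst σ Δ * √ε := by
    rintro _ ⟨u, hu, rfl⟩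
    obtain ⟨y, hy, hyu⟩ := exists_dist_le_hausdorffDist (h.isCompact_offsetCurve σ).isBounded
      hA₀ hA₀' (mem_offsetCurve f N σ hu)
    exact ⟨_, mem_image_of_mem _ hy, h.dist_midpoint_le hσ hε.le hσΔ hu
      (by rw [dist_comm]; exact hyu.trans h₀) (by linarith [(abs_le.1 (level₁ y hy)).2])
      (width y hy)⟩
  have hconst := two_mul_le_medialConst_mul_sqrt (σ := σ) hε0 (by linarith : ε ≤ Δ)
  simp only [← dist_eq_norm]
  refine ⟨near_curve, curve_near, hausdorffDist_le_of_mem_dist (by linarith) ?_ ?_⟩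
  · exact fun m hm => (near_curve m hm).imp fun x hx => ⟨hx.1, hx.2.trans hconst⟩
  · simpa only [dist_comm] using curve_near

end IsTube

section DensityBounds

variable {φ : Plane → ℝ} {h : ℝ → ℝ} {σ β : ℝ}

/-- The part of the assumptions on the position density `h` and the noise density `φ` on which the
covering rate depends: `h` is bounded below on `[0,1]`, and `φ` lives on the disc of radius `σ` and
decays at its rim no faster than `(σ - ‖v‖) ^ β`. -/
structure HasDensityLowerBounds (h : ℝ → ℝ) (φ : Plane → ℝ) (σ β : ℝ) : Prop where
  exponent_nonneg : 0 ≤ β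
  position : ∃ c, 0 < c ∧ ∀ u ∈ Icc (0 : ℝ) 1, c ≤ h u
  support : ∀ x, σ < ‖x‖ → φ x = 0
  noise : ∃ c, 0 < c ∧ ∀ v, ‖v‖ < σ → c * (σ - ‖v‖) ^ β ≤ φ v

namespace IsNoiseDensity

lemma exists_lower_bound_near_rim (hφ : IsNoiseDensity φ σ β) :
    ∃ c, 0 < c ∧ ∃ l < σ, ∀ x, l < ‖x‖ → ‖x‖ < σ → c * (σ - ‖x‖) ^ β ≤ φ x := by
  obtain ⟨-, a, ha, hequiv⟩ := hφ.boundary_behavior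
  obtain ⟨b, hb, hbound⟩ := hequiv.isBigO_symm.exists_pos
  have hevent := hbound.bound
  rw [eventually_comap] at hevent
  obtain ⟨l, hl, hlσ⟩ := (mem_nhdsLT_iff_exists_Ioo_subset' (sub_one_lt σ)).1 hevent
  refine ⟨a / b, div_pos ha hb, l, hl, fun x hlx hxσ => ?_⟩
  have hx := hlσ ⟨hlx, hxσ⟩ x rfl
  have : 0 ≤ (σ - ‖x‖) ^ β := Real.rpow_nonneg (by linarith) _
  rw [Real.norm_of_nonneg (by positivity), Real.norm_of_nonneg (hφ.nonneg x)] at hx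
  rw [div_mul_eq_mul_div, div_le_iff₀ hb]
  linarith

lemma exists_lower_bound (hφ : IsNoiseDensity φ σ β) (hσ : 0 < σ) :
    ∃ c, 0 < c ∧ ∀ v, ‖v‖ < σ → c * (σ - ‖v‖) ^ β ≤ φ v := by
  obtain ⟨c, hc, l, hl, hrim⟩ := hφ.exists_lower_bound_near_rim
  obtain ⟨m, hlm, hmσ⟩ := exists_between (max_lt hl hσ)
  obtain ⟨hlm, h0m⟩ := max_lt_iff.1 hlm
  set xm : Plane := EuclideanSpace.single 0 m
  have norm_xm : ‖xm‖ = m := by simp [xm, abs_of_pos h0m]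
  have : 0 < (σ - m) ^ β := Real.rpow_pos_of_pos (by linarith) _
  have hσβ : 0 < σ ^ β := Real.rpow_pos_of_pos hσ _
  refine ⟨min c (c * (σ - m) ^ β / σ ^ β), by positivity, fun v hv => ?_⟩
  have hdepth : 0 ≤ (σ - ‖v‖) ^ β := Real.rpow_nonneg (by linarith) _
  rcases lt_or_ge l ‖v‖ with hlv | hvl
  · exact (mul_le_mul_of_nonneg_right (min_le_left _ _) hdepth).trans (hrim v hlv hv)
  calc min c (c * (σ - m) ^ β / σ ^ β) * (σ - ‖v‖) ^ β
      ≤ c * (σ - m) ^ β / σ ^ β * σ ^ β := by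
        gcongr
        · exact min_le_right _ _
        · exact hφ.boundary_behavior.1
        · linarith [norm_nonneg v]
    _ = c * (σ - ‖xm‖) ^ β := by rw [div_mul_cancel₀ _ hσβ.ne', norm_xm]
    _ ≤ φ xm := hrim xm (by rwa [norm_xm]) (by rwa [norm_xm])
    _ ≤ φ v := hφ.nonincreasing v xm (by rw [norm_xm]; linarith)

end IsNoiseDensity

lemma IsPositionDensity.hasDensityLowerBounds (hh : IsPositionDensity h)
    (hφ : IsNoiseDensity φ σ β) (hσ : 0 < σ) : HasDensityLowerBounds h φ σ β where
  exponent_nonneg := hφ.boundary_behavior.1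
  position :=
    let ⟨c, _, hc, hcb⟩ := hh.bounds
    ⟨c, hc, fun u hu => (hcb u hu).1⟩
  support := hφ.support
  noise := hφ.exists_lower_bound hσ

instance sFinite_noiseLaw (φ : Plane → ℝ) : SFinite (noiseLaw φ) := by
  unfold noiseLaw; infer_instance

lemma positionLaw_Icc_ge {c a d : ℝ} (hc : ∀ u ∈ Icc (0 : ℝ) 1, c ≤ h u)
    (ha : Icc a (a + d) ⊆ Icc (0 : ℝ) 1) :
    ENNReal.ofReal c * ENNReal.ofReal d ≤ positionLaw h (Icc a (a + d)) := by
  rw [positionLaw, withDensity_apply _ measurableSet_Icc,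
    Measure.restrict_restrict measurableSet_Icc, inter_eq_left.2 ha]
  calc ENNReal.ofReal c * ENNReal.ofReal d = ∫⁻ _ in Icc a (a + d), ENNReal.ofReal c := by
        rw [setLIntegral_const, Real.volume_Icc, add_sub_cancel_left]
    _ ≤ ∫⁻ u in Icc a (a + d), ENNReal.ofReal (h u) := setLIntegral_mono' measurableSet_Icc
        fun u hu => ENNReal.ofReal_le_ofReal (hc u (ha hu))

lemma noiseLaw_closedBall_ge {c ρ η : ℝ} {z : Plane} (hβ : 0 ≤ β) (hc : 0 ≤ c)
    (hφ : ∀ v, ‖v‖ < σ → c * (σ - ‖v‖) ^ β ≤ φ v) (hη : 0 < η) (hρη : ρ ≤ η / 4)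
    (hz : ‖z‖ ≤ σ - η / 2) :
    ENNReal.ofReal (c * (η / 4) ^ β) * (ENNReal.ofReal ρ ^ 2 * ENNReal.ofReal Real.pi) ≤
      noiseLaw φ (closedBall z ρ) := by
  rw [noiseLaw, withDensity_apply _ measurableSet_closedBall,
    ← EuclideanSpace.volume_closedBall_fin_two z ρ, ← setLIntegral_const]
  refine setLIntegral_mono' measurableSet_closedBall fun v hv => ENNReal.ofReal_le_ofReal ?_
  have hvσ : ‖v‖ ≤ σ - η / 4 := by
    linarith [norm_le_norm_add_norm_sub' v z, mem_closedBall_iff_norm.1 hv]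
  refine le_trans ?_ (hφ v (by linarith))
  gcongr
  linarith

end DensityBounds

section HitProbability

variable {f N : ℝ → Plane} {g : Plane → ℝ} {h : ℝ → ℝ} {φ : Plane → ℝ} {Δ ℓ σ β η ρ u : ℝ}
  {x : Plane}

namespace IsTube

lemma mul_abs_inner_normal_le (ht : IsTube f N g Δ) (hu : u ∈ Icc (0 : ℝ) 1) {y : Plane}
    (hy : y ∈ filament f) : 2 * Δ * |inner ℝ (N u) (y - f u)| ≤ ‖y - f u‖ ^ 2 := by
  have hgy : g y = 0 := by
    rw [← abs_eq_zero, ← ht.infDist_filament, infDist_zero_of_mem hy]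
  have habove := ht.mul_inner_normal_le hu 0 (hgy.trans_le ht.radius_pos.le)
  have hbelow := ht.neg.mul_inner_normal_le hu 0 (y := y) (by simp [hgy, ht.radius_pos.le])
  simp only [hgy, zero_smul, add_zero, sub_zero, neg_zero, inner_neg_left] at habove hbelow
  rcases abs_cases (inner ℝ (N u) (y - f u)) with ⟨habs, -⟩ | ⟨habs, -⟩ <;> rw [habs] <;> linarith

/-- By tangency, moving the foot point of `x` by `w` along the curve increases the squared distance
to `x` by `O(‖w‖ ^ 2)` only. -/
lemma exists_foot_forall_norm_sub_le (ht : IsTube f N g Δ)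
    (hlip : ∀ u ∈ Icc (0 : ℝ) 1, ∀ v ∈ Icc (0 : ℝ) 1, ‖f v - f u‖ ≤ ℓ * |v - u|)
    (hσΔ : σ < Δ) (hη : 0 < η) (hx : infDist x (filament f) ≤ σ - η) :
    ∃ u₀ ∈ Icc (0 : ℝ) 1, ∀ u ∈ Icc (0 : ℝ) 1, 8 * (ℓ * |u - u₀|) ^ 2 ≤ σ * η →
      ‖x - f u‖ ≤ σ - η / 2 := by
  obtain ⟨u₀, hu₀, hxu⟩ := ht.exists_eq x
  rw [ht.infDist_filament] at hx
  set t := g x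
  refine ⟨u₀, hu₀, fun u hu hsmall => ?_⟩
  set w := f u - f u₀ with hw
  have hxw : x - f u = t • N u₀ - w := by
    rw [hw]; nth_rewrite 1 [hxu]; abel
  have hw_sq : ‖w‖ ^ 2 ≤ (ℓ * |u - u₀|) ^ 2 := by
    gcongr; exact hlip u₀ hu₀ u hu
  have hinner : -(2 * (t * inner ℝ (N u₀) w)) ≤ ‖w‖ ^ 2 := by
    calc -(2 * (t * inner ℝ (N u₀) w)) ≤ 2 * (|t| * |inner ℝ (N u₀) w|) := by
          rw [← abs_mul]; linarith [neg_abs_le (t * inner ℝ (N u₀) w)]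
      _ ≤ 2 * (Δ * |inner ℝ (N u₀) w|) := by gcongr; linarith
      _ ≤ ‖w‖ ^ 2 := by
          rw [← mul_assoc]; exact ht.mul_abs_inner_normal_le hu₀ (mem_filament f hu)
  have ht_sq : |t| ^ 2 ≤ (σ - η) ^ 2 := by gcongr
  have := abs_nonneg t
  refine abs_le_of_sq_le_sq' ?_ (by linarith) |>.2
  rw [hxw, norm_sub_sq_real, real_inner_smul_left, norm_smul, ht.norm_normal u₀ hu₀, mul_one,
    Real.norm_eq_abs]
  nlinarith

end IsTube

lemma exists_Icc_subset_near {u₀ d : ℝ} (hu₀ : u₀ ∈ Icc (0 : ℝ) 1) (hd : 0 ≤ d)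
    (hd' : d ≤ 1 / 2) :
    ∃ a, Icc a (a + d) ⊆ Icc (0 : ℝ) 1 ∧ ∀ u ∈ Icc a (a + d), |u - u₀| ≤ d := by
  rcases le_total u₀ (1 / 2) with h | h
  · refine ⟨u₀, Icc_subset_Icc hu₀.1 (by linarith), fun u hu => abs_le.2 ⟨?_, ?_⟩⟩ <;>
      linarith [hu.1, hu.2]
  · refine ⟨u₀ - d, Icc_subset_Icc (by linarith) (by linarith [hu₀.2]), fun u hu =>
      abs_le.2 ⟨?_, ?_⟩⟩ <;> linarith [hu.1, hu.2]

lemma exists_mul_sqrt_le (hσ : 0 < σ) (hℓ : 0 < ℓ) :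
    ∃ k, 0 < k ∧ ∀ η, 0 ≤ η → η ≤ σ → k * √η ≤ 1 / 2 ∧ 8 * (ℓ * (k * √η)) ^ 2 ≤ σ * η := by
  have : 0 < √σ := Real.sqrt_pos.2 hσ
  refine ⟨min (√σ / (4 * ℓ)) (1 / (2 * √σ)), by positivity, fun η hη hησ => ⟨?_, ?_⟩⟩
  · calc min (√σ / (4 * ℓ)) (1 / (2 * √σ)) * √η ≤ 1 / (2 * √σ) * √σ := by
          gcongr; exact min_le_right _ _
      _ = 1 / 2 := by field_simp
  · calc 8 * (ℓ * (min (√σ / (4 * ℓ)) (1 / (2 * √σ)) * √η)) ^ 2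
        ≤ 8 * (ℓ * (√σ / (4 * ℓ) * √η)) ^ 2 := by gcongr; exact min_le_left _ _
      _ = √σ ^ 2 * √η ^ 2 / 2 := by field_simp; ring
      _ ≤ σ * η := by
          rw [Real.sq_sqrt hσ.le, Real.sq_sqrt hη]
          linarith [mul_nonneg hσ.le hη]

/-- The pairs (position, noise) for which the observation falls into the closed ball with centre
`x` and radius `ρ`. The curve is extended by constants outside `[0,1]`, which makes this set closed
and hence measurable. -/
def hitSet (f : ℝ → Plane) (x : Plane) (ρ : ℝ) : Set (ℝ × Plane) :=
  {q | IccExtend zero_le_one ((Icc (0 : ℝ) 1).domRestrict f) q.1 + q.2 ∈ closedBall x ρ}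

lemma mk_mem_hitSet_iff (hu : u ∈ Icc (0 : ℝ) 1) {v : Plane} :
    (u, v) ∈ hitSet f x ρ ↔ dist (f u + v) x ≤ ρ := by
  simp only [hitSet, mem_ofPred_eq, mem_closedBall, IccExtend_of_mem _ _ hu, domRestrict_apply]

lemma preimage_hitSet (hu : u ∈ Icc (0 : ℝ) 1) :
    Prod.mk u ⁻¹' hitSet f x ρ = closedBall (x - f u) ρ := by
  ext v
  rw [mem_preimage, mk_mem_hitSet_iff hu, mem_closedBall, dist_eq_norm, dist_eq_norm,
    sub_sub_eq_add_sub, add_comm]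

lemma isClosed_hitSet (hf : ContinuousOn f (Icc 0 1)) (x : Plane) (ρ : ℝ) :
    IsClosed (hitSet f x ρ) := by
  have : Continuous (IccExtend zero_le_one ((Icc (0 : ℝ) 1).domRestrict f)) :=
    (continuousOn_iff_continuous_domRestrict.1 hf).Icc_extend'
  exact isClosed_closedBall.preimage ((this.comp continuous_fst).add continuous_snd)

lemma mul_le_measure_prod {X Y : Type*} [MeasurableSpace X] [MeasurableSpace Y] {μ : Measure X}
    {ν : Measure Y} [SFinite ν] {A : Set X} {B : Set (X × Y)} {b : ENNReal}
    (hA : MeasurableSet A) (hB : MeasurableSet B) (hb : ∀ x ∈ A, b ≤ ν (Prod.mk x ⁻¹' B)) :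
    μ A * b ≤ μ.prod ν B := by
  rw [Measure.prod_apply hB, mul_comm, ← setLIntegral_const]
  exact (setLIntegral_mono' hA hb).trans (setLIntegral_le_lintegral _ _)

lemma hitSet_probability_ge (ht : IsTube f N g Δ) (hℓ : 0 < ℓ)
    (hlip : ∀ u ∈ Icc (0 : ℝ) 1, ∀ v ∈ Icc (0 : ℝ) 1, ‖f v - f u‖ ≤ ℓ * |v - u|)
    (hσ : 0 < σ) (hσΔ : σ < Δ) (hhφ : HasDensityLowerBounds h φ σ β) :
    ∃ c, 0 < c ∧ ∀ x η ρ, 0 < η → 0 ≤ ρ → ρ ≤ η / 4 → infDist x (filament f) ≤ σ - η →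
      ENNReal.ofReal (c * ρ ^ 2 * η ^ (β + 1 / 2)) ≤
        ((positionLaw h).prod (noiseLaw φ)) (hitSet f x ρ) := by
  obtain ⟨c₁, hc₁, hh⟩ := hhφ.position
  obtain ⟨c₂, hc₂, hφ⟩ := hhφ.noise
  obtain ⟨k, hk, hkη⟩ := exists_mul_sqrt_le hσ hℓ
  refine ⟨c₁ * k * (c₂ * (1 / 4) ^ β) * Real.pi, by positivity, fun x η ρ hη hρ hρη hx => ?_⟩
  obtain ⟨hd, hkη⟩ := hkη η hη.le (by linarith [infDist_nonneg (x := x) (s := filament f)])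
  obtain ⟨u₀, hu₀, hnear⟩ := ht.exists_foot_forall_norm_sub_le hlip hσΔ hη hx
  obtain ⟨a, ha, hau⟩ := exists_Icc_subset_near hu₀ (by positivity) hd
  have slice_ge : ∀ u ∈ Icc a (a + k * √η), ENNReal.ofReal (c₂ * (η / 4) ^ β) *
      (ENNReal.ofReal ρ ^ 2 * ENNReal.ofReal Real.pi) ≤
        noiseLaw φ (Prod.mk u ⁻¹' hitSet f x ρ) := by
    intro u hu
    rw [preimage_hitSet (ha hu)]
    refine noiseLaw_closedBall_ge hhφ.exponent_nonneg hc₂.le hφ hη hρη (hnear u (ha hu) ?_)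
    refine le_trans ?_ hkη
    gcongr
    exact hau u hu
  calc ENNReal.ofReal (c₁ * k * (c₂ * (1 / 4) ^ β) * Real.pi * ρ ^ 2 * η ^ (β + 1 / 2))
      = ENNReal.ofReal c₁ * ENNReal.ofReal (k * √η) * (ENNReal.ofReal (c₂ * (η / 4) ^ β) *
          (ENNReal.ofReal ρ ^ 2 * ENNReal.ofReal Real.pi)) := by
        rw [← ENNReal.ofReal_pow hρ, ← ENNReal.ofReal_mul (by positivity),
          ← ENNReal.ofReal_mul (by positivity), ← ENNReal.ofReal_mul (by positivity),
          ← ENNReal.ofReal_mul (by positivity), Real.rpow_add hη, ← Real.sqrt_eq_rpow,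
          div_eq_mul_one_div η, Real.mul_rpow hη.le (by norm_num)]
        congr 1
        ring
    _ ≤ positionLaw h (Icc a (a + k * √η)) * (ENNReal.ofReal (c₂ * (η / 4) ^ β) *
          (ENNReal.ofReal ρ ^ 2 * ENNReal.ofReal Real.pi)) := by
        gcongr
        exact positionLaw_Icc_ge hh ha
    _ ≤ ((positionLaw h).prod (noiseLaw φ)) (hitSet f x ρ) :=
        mul_le_measure_prod measurableSet_Icc (isClosed_hitSet ht.continuousOn x ρ).measurableSet
          slice_ge

end HitProbability

section Rate

variable {β : ℝ} {n : ℕ}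

lemma rate_pos (hn : 2 ≤ n) : 0 < rate β n := by
  have : 0 < Real.log n := Real.log_pos (by exact_mod_cast hn)
  unfold rate
  positivity

lemma rate_rpow (hβ : 0 ≤ β) (n : ℕ) : rate β n ^ (2 + (β + 1 / 2)) = Real.log n / n := by
  rw [rate, ← Real.rpow_mul (div_nonneg (Real.log_natCast_nonneg n) (Nat.cast_nonneg n)),
    one_div_mul_cancel (by positivity), Real.rpow_one]

lemma mul_mul_rate_rpow (hβ : 0 ≤ β) (hn : 2 ≤ n) (c : ℝ) {ρ κ : ℝ} (hκ : 0 ≤ κ) :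
    n * (c * (ρ * rate β n) ^ 2 * (κ * rate β n) ^ (β + 1 / 2)) =
      c * ρ ^ 2 * κ ^ (β + 1 / 2) * Real.log n := by
  have hr := rate_pos (β := β) hn
  have hlog : n * rate β n ^ (2 + (β + 1 / 2)) = Real.log n := by
    rw [rate_rpow hβ, mul_div_cancel₀ _ (by positivity)]
  rw [← hlog, Real.rpow_add hr, Real.mul_rpow hκ hr.le, Real.rpow_two]
  ring

lemma tendsto_rate (hβ : 0 ≤ β) : Tendsto (rate β) atTop (𝓝 0) := by
  have hlog : Tendsto (fun n : ℕ => Real.log n / n) atTop (𝓝 0) := by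
    have := Real.tendsto_pow_log_div_mul_add_atTop 1 0 1 one_ne_zero
    simp only [pow_one, one_mul, add_zero] at this
    exact this.comp tendsto_natCast_atTop_atTop
  have := hlog.rpow_const (p := 1 / (2 + (β + 1 / 2))) (Or.inr (by positivity))
  rwa [Real.zero_rpow (by positivity)] at this

lemma eventually_mul_rate_lt (hβ : 0 ≤ β) (c : ℝ) {δ : ℝ} (hδ : 0 < δ) :
    ∀ᶠ n in atTop, c * rate β n < δ :=
  ((tendsto_rate hβ).const_mul c).eventually_lt_const (by rwa [mul_zero])

lemma sqrt_le_mul_rate (hβ : 0 ≤ β) (hn : 3 ≤ n) : √n ≤ n * rate β n := by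
  have : (3 : ℝ) ≤ n := by exact_mod_cast hn
  have hlog : 1 ≤ Real.log n := by
    rw [Real.le_log_iff_exp_le (by positivity)]
    linarith [Real.exp_one_lt_d9]
  calc √n = n * (1 / n : ℝ) ^ (1 / 2 : ℝ) := by
        rw [← Real.sqrt_eq_rpow, Real.sqrt_div zero_le_one, Real.sqrt_one, mul_one_div,
          Real.div_sqrt]
    _ ≤ n * (1 / n : ℝ) ^ (1 / (2 + (β + 1 / 2))) := by
        gcongr n * ?_
        refine Real.rpow_le_rpow_of_exponent_ge (by positivity) ?_ ?_
        · rw [div_le_one (by positivity)]; linarith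
        · apply one_div_le_one_div_of_le <;> linarith
    _ ≤ n * rate β n := by
        unfold rate; gcongr

lemma eventually_div_le_mul_rate (hβ : 0 ≤ β) (R : ℝ) {c : ℝ} (hc : 0 < c) :
    ∀ᶠ n : ℕ in atTop, R / n ≤ c * rate β n := by
  have hsqrt : Tendsto (fun n : ℕ => √(n : ℝ)) atTop atTop :=
    Real.tendsto_sqrt_atTop.comp tendsto_natCast_atTop_atTop
  filter_upwards [hsqrt.eventually_ge_atTop (R / c), eventually_ge_atTop 3] with n hR hn
  have hle := hR.trans (sqrt_le_mul_rate hβ hn)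
  rw [div_le_iff₀ hc] at hle
  rw [div_le_iff₀ (by positivity)]
  linarith

end Rate

section Grid

/-- The points of the square grid of mesh `R / n`. Those with indices in `gridIndex n` lie in the
square of half side `R`. -/
noncomputable def gridPoint (R : ℝ) (n : ℕ) (k : ℤ × ℤ) : Plane :=
  !₂[R * k.1 / n, R * k.2 / n]

/-- The indices `k` with both entries between `-n` and `n`. -/
noncomputable def gridIndex (n : ℕ) : Finset (ℤ × ℤ) :=
  Finset.Icc (-n : ℤ) n ×ˢ Finset.Icc (-n : ℤ) n

lemma card_gridIndex (n : ℕ) : (gridIndex n).card = (2 * n + 1) ^ 2 := by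
  have : (Finset.Icc (-n : ℤ) n).card = 2 * n + 1 := by
    rw [Int.card_Icc]; omega
  rw [gridIndex, Finset.card_product, this, sq]

lemma exists_grid_coord {R t : ℝ} (hR : 0 < R) {n : ℕ} (hn : 0 < n) (ht : |t| ≤ R) :
    ∃ k ∈ Finset.Icc (-n : ℤ) n, |t - R * k / n| ≤ R / n := by
  have hn' : (0 : ℝ) < n := by exact_mod_cast hn
  obtain ⟨hleft, hright⟩ := abs_le.1 ht
  have hfloor := Int.floor_le (t * n / R)
  have hfloor' := Int.lt_floor_add_one (t * n / R)
  refine ⟨⌊t * n / R⌋, Finset.mem_Icc.2 ⟨?_, ?_⟩, ?_⟩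
  · rw [Int.le_floor]; push_cast; rw [le_div_iff₀ hR]; nlinarith
  · have : (⌊t * n / R⌋ : ℝ) ≤ n := hfloor.trans (by rw [div_le_iff₀ hR]; nlinarith)
    exact_mod_cast this
  · rw [le_div_iff₀ hR] at hfloor
    rw [div_lt_iff₀ hR] at hfloor'
    have hdiff : t - R * ⌊t * n / R⌋ / n = (t * n - ⌊t * n / R⌋ * R) / n := by field_simp
    rw [hdiff, abs_div, abs_of_pos hn', abs_of_nonneg (by linarith)]
    gcongr
    linarith

lemma exists_gridPoint {R : ℝ} (hR : 0 < R) {n : ℕ} (hn : 0 < n) {x : Plane} (hx : ‖x‖ ≤ R) :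
    ∃ k ∈ gridIndex n, dist x (gridPoint R n k) ≤ 2 * R / n := by
  obtain ⟨i, hi, hi'⟩ := exists_grid_coord hR hn ((PiLp.norm_apply_le x 0).trans hx)
  obtain ⟨j, hj, hj'⟩ := exists_grid_coord hR hn ((PiLp.norm_apply_le x 1).trans hx)
  refine ⟨(i, j), Finset.mem_product.2 ⟨hi, hj⟩, ?_⟩
  have hi_sq : (x 0 - R * i / n) ^ 2 ≤ (R / n) ^ 2 := sq_le_sq.2 (hi'.trans (le_abs_self _))
  have hj_sq : (x 1 - R * j / n) ^ 2 ≤ (R / n) ^ 2 := sq_le_sq.2 (hj'.trans (le_abs_self _))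
  rw [dist_eq_norm, mul_div_assoc]
  refine abs_le_of_sq_le_sq' ?_ (by positivity) |>.2
  rw [plane_norm_sq]
  simp only [gridPoint, PiLp.sub_apply, Matrix.cons_val_zero, Matrix.cons_val_one]
  nlinarith [sq_nonneg (R / n)]

end Grid

section BorelCantelli

variable {Ω : Type*} [MeasurableSpace Ω] {P : Measure Ω}

lemma tsum_ne_top_of_eventually_le_ofReal {a : ℕ → ENNReal} {b : ℕ → ℝ} (hb : Summable b)
    (ha : ∀ n, a n ≠ ⊤) (hab : ∀ᶠ n in atTop, a n ≤ ENNReal.ofReal (b n)) : ∑' n, a n ≠ ⊤ := by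
  obtain ⟨m, hm⟩ := eventually_atTop.1 hab
  have htail : ∑' n, a (n + m) ≠ ⊤ :=
    ne_top_of_le_ne_top ((summable_nat_add_iff m).2 hb).tsum_ofReal_ne_top
      (ENNReal.tsum_le_tsum fun n => hm (n + m) (Nat.le_add_left m n))
  rw [← ENNReal.summable.sum_add_tsum_nat_add' (f := a) (k := m)]
  exact ENNReal.add_ne_top.2 ⟨ENNReal.sum_ne_top.2 fun i _ => ha i, htail⟩

lemma ae_eventually_forall_gridIndex_notMem [IsFiniteMeasure P] {bad : ℕ → ℤ × ℤ → Set Ω}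
    (hbad : ∀ n : ℕ, 2 ≤ n → ∀ k, P (bad n k) ≤ ENNReal.ofReal (1 / (n : ℝ) ^ 4)) :
    ∀ᵐ ω ∂P, ∀ᶠ n in atTop, ∀ k ∈ gridIndex n, ω ∉ bad n k := by
  have hsum : ∑' n, P (⋃ k ∈ gridIndex n, bad n k) ≠ ⊤ := by
    refine tsum_ne_top_of_eventually_le_ofReal (b := fun n => 9 * (1 / (n : ℝ) ^ 2))
      ((Real.summable_one_div_nat_pow.2 one_lt_two).mul_left 9) (fun n => measure_ne_top _ _) ?_
    filter_upwards [eventually_ge_atTop 2] with n hn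
    have hn' : (2 : ℝ) ≤ n := by exact_mod_cast hn
    calc P (⋃ k ∈ gridIndex n, bad n k) ≤ ∑ k ∈ gridIndex n, P (bad n k) :=
          measure_biUnion_finset_le _ _
      _ ≤ ∑ _k ∈ gridIndex n, ENNReal.ofReal (1 / (n : ℝ) ^ 4) :=
          Finset.sum_le_sum fun k _ => hbad n hn k
      _ = ENNReal.ofReal ((2 * n + 1) ^ 2 * (1 / (n : ℝ) ^ 4)) := by
          rw [Finset.sum_const, nsmul_eq_mul, card_gridIndex, ENNReal.ofReal_mul (by positivity),
            ← ENNReal.ofReal_natCast]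
          norm_cast
      _ ≤ ENNReal.ofReal ((3 * n) ^ 2 * (1 / (n : ℝ) ^ 4)) := by gcongr; linarith
      _ = ENNReal.ofReal (9 * (1 / (n : ℝ) ^ 2)) := by congr 1; field_simp; norm_num
  filter_upwards [ae_eventually_notMem hsum] with ω hω
  filter_upwards [hω] with n hn k hk hbad
  exact hn (mem_biUnion hk hbad)

end BorelCantelli

section Sample

variable {Ω : Type*} [MeasurableSpace Ω] {P : Measure Ω} {f N : ℝ → Plane} {g : Plane → ℝ}
  {h : ℝ → ℝ} {φ : Plane → ℝ} {U : ℕ → Ω → ℝ} {e : ℕ → Ω → Plane} {Δ ℓ σ β c κ ρ : ℝ}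

lemma ae_noiseLaw_norm_le (hφ : ∀ x, σ < ‖x‖ → φ x = 0) : ∀ᵐ x ∂(noiseLaw φ), ‖x‖ ≤ σ := by
  have hmeas : MeasurableSet {x : Plane | σ < ‖x‖} :=
    measurableSet_lt measurable_const measurable_norm
  simp only [ae_iff, not_le]
  rw [noiseLaw, withDensity_apply _ hmeas, setLIntegral_congr_fun (g := fun _ => 0) hmeas
    fun x hx => by simp only [hφ x hx, ENNReal.ofReal_zero], lintegral_zero]

namespace IsFilamentSample

lemma ae_mem (hs : IsFilamentSample P h φ U e) (hφ : ∀ x, σ < ‖x‖ → φ x = 0) :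
    ∀ᵐ ω ∂P, ∀ i, U i ω ∈ Icc (0 : ℝ) 1 ∧ ‖e i ω‖ ≤ σ := by
  have hposition : ∀ᵐ u ∂(positionLaw h), u ∈ Icc (0 : ℝ) 1 :=
    (withDensity_absolutelyContinuous _ _).ae_le (ae_restrict_mem measurableSet_Icc)
  have hpair : ∀ᵐ q ∂((positionLaw h).prod (noiseLaw φ)), q.1 ∈ Icc (0 : ℝ) 1 ∧ ‖q.2‖ ≤ σ :=
    (Measure.quasiMeasurePreserving_fst.ae hposition).and
      (Measure.quasiMeasurePreserving_snd.ae (ae_noiseLaw_norm_le hφ))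
  refine ae_all_iff.2 fun i => ?_
  rw [← (hs.law i).map_eq] at hpair
  exact ae_of_ae_map (hs.law i).aemeasurable hpair

lemma measure_forall_notMem_le [IsProbabilityMeasure P] (hs : IsFilamentSample P h φ U e)
    {B : Set (ℝ × Plane)} (hB : MeasurableSet B) {p : ℝ} (hp : 0 ≤ p)
    (hpB : ENNReal.ofReal p ≤ ((positionLaw h).prod (noiseLaw φ)) B) (n : ℕ) :
    P {ω | ∀ i ∈ Finset.range n, (U i ω, e i ω) ∉ B} ≤ ENNReal.ofReal (Real.exp (-(n * p))) := by
  have hset : {ω | ∀ i ∈ Finset.range n, (U i ω, e i ω) ∉ B} =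
      ⋂ i ∈ Finset.range n, (fun ω => (U i ω, e i ω)) ⁻¹' Bᶜ := by
    ext ω; simp
  have hone : ∀ i, P ((fun ω => (U i ω, e i ω)) ⁻¹' Bᶜ) ≤ ENNReal.ofReal (Real.exp (-p)) := by
    intro i
    have : IsProbabilityMeasure ((positionLaw h).prod (noiseLaw φ)) := by
      rw [← (hs.law i).map_eq]
      exact Measure.isProbabilityMeasure_map (hs.law i).aemeasurable
    rw [← Measure.map_apply_of_aemeasurable (hs.law i).aemeasurable hB.compl, (hs.law i).map_eq,
      prob_compl_eq_one_sub hB]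
    calc 1 - ((positionLaw h).prod (noiseLaw φ)) B ≤ 1 - ENNReal.ofReal p := by gcongr
      _ = ENNReal.ofReal (1 - p) := by rw [ENNReal.ofReal_sub _ hp, ENNReal.ofReal_one]
      _ ≤ ENNReal.ofReal (Real.exp (-p)) := ENNReal.ofReal_le_ofReal (Real.one_sub_le_exp_neg p)
  rw [hset, hs.indep.measure_inter_preimage_eq_mul _ (fun i _ => hB.compl)]
  calc ∏ i ∈ Finset.range n, P ((fun ω => (U i ω, e i ω)) ⁻¹' Bᶜ)
      ≤ ∏ _i ∈ Finset.range n, ENNReal.ofReal (Real.exp (-p)) :=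
        Finset.prod_le_prod' fun i _ => hone i
    _ = ENNReal.ofReal (Real.exp (-(n * p))) := by
        rw [Finset.prod_const, Finset.card_range, ← ENNReal.ofReal_pow (Real.exp_pos _).le,
          ← Real.exp_nat_mul, mul_neg]

lemma measure_forall_notMem_le_one_div_pow [IsProbabilityMeasure P]
    (hs : IsFilamentSample P h φ U e) {B : Set (ℝ × Plane)} (hB : MeasurableSet B) {p : ℝ}
    (hp : 0 ≤ p) (hpB : ENNReal.ofReal p ≤ ((positionLaw h).prod (noiseLaw φ)) B) {n : ℕ}
    (hn : 0 < n) {m : ℕ} (hnp : m * Real.log n ≤ n * p) :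
    P {ω | ∀ i ∈ Finset.range n, (U i ω, e i ω) ∉ B} ≤ ENNReal.ofReal (1 / (n : ℝ) ^ m) := by
  have hexp : Real.exp (-(m * Real.log n)) = 1 / (n : ℝ) ^ m := by
    rw [Real.exp_neg, Real.exp_nat_mul, Real.exp_log (by exact_mod_cast hn), one_div]
  refine (hs.measure_forall_notMem_le hB hp hpB n).trans (ENNReal.ofReal_le_ofReal ?_)
  rw [← hexp]
  gcongr

lemma ae_eventually_forall_gridIndex_hit [IsProbabilityMeasure P]
    (hs : IsFilamentSample P h φ U e) (hf : ContinuousOn f (Icc 0 1)) (hβ : 0 ≤ β)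
    (hφ : ∀ x, σ < ‖x‖ → φ x = 0) (hc : 0 ≤ c)
    (hhit : ∀ x η ρ, 0 < η → 0 ≤ ρ → ρ ≤ η / 4 → infDist x (filament f) ≤ σ - η →
      ENNReal.ofReal (c * ρ ^ 2 * η ^ (β + 1 / 2)) ≤
        ((positionLaw h).prod (noiseLaw φ)) (hitSet f x ρ))
    (hρ : 0 < ρ) (hρκ : ρ ≤ κ / 4) (hcρκ : 4 ≤ c * ρ ^ 2 * κ ^ (β + 1 / 2)) (R : ℝ) :
    ∀ᵐ ω ∂P, ∀ᶠ n : ℕ in atTop, ∀ k ∈ gridIndex n,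
      infDist (gridPoint R n k) (filament f) ≤ σ - κ * rate β n →
        ∃ i ∈ Finset.range n, dist (f (U i ω) + e i ω) (gridPoint R n k) ≤ ρ * rate β n := by
  have hbad : ∀ n : ℕ, 2 ≤ n → ∀ k, P {ω | infDist (gridPoint R n k) (filament f) ≤
      σ - κ * rate β n ∧ ∀ i ∈ Finset.range n,
        (U i ω, e i ω) ∉ hitSet f (gridPoint R n k) (ρ * rate β n)} ≤
      ENNReal.ofReal (1 / (n : ℝ) ^ 4) := by
    intro n hn k
    have hr := rate_pos (β := β) hn
    have hκ : 0 < κ := by linarith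
    by_cases hdeep : infDist (gridPoint R n k) (filament f) ≤ σ - κ * rate β n
    · simp only [hdeep, true_and]
      refine hs.measure_forall_notMem_le_one_div_pow (isClosed_hitSet hf _ _).measurableSet
        (by positivity) (hhit _ _ _ (by positivity) (by positivity) (by nlinarith) hdeep)
        (by omega) ?_
      rw [mul_mul_rate_rpow hβ hn c hκ.le]
      exact mul_le_mul_of_nonneg_right (by exact_mod_cast hcρκ) (Real.log_natCast_nonneg n)
    · simp [hdeep]
  filter_upwards [ae_eventually_forall_gridIndex_notMem hbad, hs.ae_mem hφ] with ω hω hmem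
  filter_upwards [hω] with n hn k hk hdeep
  have := hn k hk
  simp only [hdeep, true_and, not_forall, not_not] at this
  obtain ⟨i, hi, hit⟩ := this
  exact ⟨i, hi, (mk_mem_hitSet_iff (hmem i).1).1 hit⟩

end IsFilamentSample

lemma exists_norm_le_of_infDist_filament_le (hf : ContinuousOn f (Icc 0 1)) (σ : ℝ) :
    ∃ R, 0 < R ∧ ∀ x, infDist x (filament f) ≤ σ → ‖x‖ ≤ R := by
  obtain ⟨R, hR, hRle⟩ :=
    ((isCompact_filament hf).isBounded.thickening (δ := σ + 1)).exists_pos_norm_le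
  exact ⟨R, hR, fun x hx => hRle x
    ((mem_thickening_iff_infDist_lt (filament_nonempty f)).2 (by linarith))⟩

/-- It suffices that the observations hit half-size balls around the grid points at half the depth,
since the mesh of the grid is eventually small compared with `rate β n`. -/
lemma exists_ae_eventually_cover [IsProbabilityMeasure P] (ht : IsTube f N g Δ) (hℓ : 0 < ℓ)
    (hlip : ∀ u ∈ Icc (0 : ℝ) 1, ∀ v ∈ Icc (0 : ℝ) 1, ‖f v - f u‖ ≤ ℓ * |v - u|)
    (hσ : 0 < σ) (hσΔ : σ < Δ) (hhφ : HasDensityLowerBounds h φ σ β)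
    (hs : IsFilamentSample P h φ U e) :
    ∃ M, 0 < M ∧ ∀ ρ K : ℝ, 0 < ρ → ρ ≤ K / 4 → M ≤ ρ ^ 2 * K ^ (β + 1 / 2) →
      ∀ᵐ ω ∂P, ∀ᶠ n : ℕ in atTop, ∀ x, infDist x (filament f) ≤ σ - K * rate β n →
        ∃ i ∈ Finset.range n, dist (f (U i ω) + e i ω) x ≤ ρ * rate β n := by
  obtain ⟨c, hc, hhit⟩ := hitSet_probability_ge ht hℓ hlip hσ hσΔ hhφ
  have hβ := hhφ.exponent_nonneg
  obtain ⟨R, hR, hnorm⟩ := exists_norm_le_of_infDist_filament_le ht.continuousOn σ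
  refine ⟨16 * 2 ^ (β + 1 / 2) / c, by positivity, fun ρ K hρ hρK hM => ?_⟩
  have hcρK : 4 ≤ c * (ρ / 2) ^ 2 * (K / 2) ^ (β + 1 / 2) := by
    rw [div_le_iff₀ hc] at hM
    rw [Real.div_rpow (by linarith) zero_le_two, mul_div_assoc', le_div_iff₀ (by positivity)]
    linarith
  filter_upwards [hs.ae_eventually_forall_gridIndex_hit ht.continuousOn hβ hhφ.support hc.le hhit
    (half_pos hρ) (by linarith) hcρK R] with ω hω
  filter_upwards [hω, eventually_div_le_mul_rate hβ (2 * R) (half_pos hρ),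
    eventually_ge_atTop 2] with n hn hmesh hn2 x hx
  have hr := rate_pos (β := β) hn2
  obtain ⟨k, hk, hxk⟩ :=
    exists_gridPoint hR (Nat.zero_lt_of_lt hn2) (hnorm x (hx.trans (by nlinarith)))
  have := hxk.trans hmesh
  have hdeep : infDist (gridPoint R n k) (filament f) ≤ σ - K / 2 * rate β n := by
    have := infDist_le_infDist_add_dist (s := filament f) (x := gridPoint R n k) (y := x)
    rw [dist_comm] at this
    nlinarith
  obtain ⟨i, hi, hik⟩ := hn k hk hdeep
  refine ⟨i, hi, (dist_triangle_right _ _ (gridPoint R n k)).trans ?_⟩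
  linarith

end Sample

section UnionOfBalls

variable {Y : ℕ → Plane} {n : ℕ} {R : ℝ} {x : Plane}

lemma mem_unionOfBalls : x ∈ unionOfBalls Y n R ↔ ∃ i ∈ Finset.range n, dist (Y i) x ≤ R := by
  simp only [unionOfBalls, mem_iUnion, mem_closedBall, exists_prop, dist_comm]

lemma isCompact_unionOfBalls (Y : ℕ → Plane) (n : ℕ) (R : ℝ) : IsCompact (unionOfBalls Y n R) :=
  (Finset.range n).isCompact_biUnion fun _ _ => isCompact_closedBall _ _

lemma isClosed_unionOfBalls (Y : ℕ → Plane) (n : ℕ) (R : ℝ) : IsClosed (unionOfBalls Y n R) :=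
  (isCompact_unionOfBalls Y n R).isClosed

lemma mem_interior_unionOfBalls (h : ∃ i ∈ Finset.range n, dist (Y i) x < R) :
    x ∈ interior (unionOfBalls Y n R) := by
  obtain ⟨i, hi, hx⟩ := h
  exact interior_mono (subset_biUnion_of_mem (u := fun i => closedBall (Y i) R) hi)
    (ball_subset_interior_closedBall (by rwa [mem_ball, dist_comm]))

lemma mem_frontier_unionOfBalls : x ∈ frontier (unionOfBalls Y n R) ↔
    x ∈ unionOfBalls Y n R ∧ x ∉ interior (unionOfBalls Y n R) := by
  rw [(isClosed_unionOfBalls Y n R).frontier_eq, Set.mem_sdiff]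

/-- The first `n` centers `Y i` lie within `σ` of `Γ`, and the open balls of radius `R` around them
cover the points within `d` of `Γ`. Depending on the sign of `d - σ`, the boundary of the union of
the balls is close to that of the `σ`-neighbourhood of `Γ`, or lies entirely outside of it. -/
structure BallsCover (Γ : Set Plane) (Y : ℕ → Plane) (n : ℕ) (σ d R : ℝ) : Prop where
  near : ∀ i ∈ Finset.range n, infDist (Y i) Γ ≤ σ
  cover : ∀ x, infDist x Γ ≤ d → ∃ i ∈ Finset.range n, dist (Y i) x < R

namespace BallsCover

variable {Γ : Set Plane} {σ d : ℝ}

lemma infDist_le (hc : BallsCover Γ Y n σ d R) (hx : x ∈ unionOfBalls Y n R) :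
    infDist x Γ ≤ σ + R := by
  obtain ⟨i, hi, hix⟩ := mem_unionOfBalls.1 hx
  have := infDist_le_infDist_add_dist (s := Γ) (x := x) (y := Y i)
  rw [dist_comm] at this
  linarith [hc.near i hi]

lemma mem_interior (hc : BallsCover Γ Y n σ d R) (hx : infDist x Γ ≤ d) :
    x ∈ interior (unionOfBalls Y n R) :=
  mem_interior_unionOfBalls (hc.cover x hx)

lemma lt_infDist (hc : BallsCover Γ Y n σ d R) (hx : x ∈ frontier (unionOfBalls Y n R)) :
    d < infDist x Γ :=
  lt_of_not_ge fun hd => (mem_frontier_unionOfBalls.1 hx).2 (hc.mem_interior hd)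

lemma radius_pos (hc : BallsCover Γ Y n σ d R) (hΓ : Γ.Nonempty) (hd : 0 ≤ d) : 0 < R := by
  obtain ⟨x, hx⟩ := hΓ
  obtain ⟨i, -, hi⟩ := hc.cover x ((infDist_zero_of_mem hx).trans_le hd)
  exact dist_nonneg.trans_lt hi

lemma enlarge (hc : BallsCover Γ Y n σ d R) (hΓ : IsCompact Γ) (hΓ' : Γ.Nonempty) (hd : 0 ≤ d)
    {b : ℝ} (hb : 0 ≤ b) : BallsCover Γ Y n σ (d + b) (R + b) where
  near := hc.near
  cover x hx := by
    obtain ⟨p, hp, hxp⟩ := hΓ.exists_infDist_eq_dist hΓ' x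
    obtain ⟨y, hxy, hyp⟩ := exists_dist_le_le hb hd (hxp ▸ hx)
    obtain ⟨i, hi, hiy⟩ := hc.cover y ((infDist_le_dist_of_mem hp).trans hyp)
    exact ⟨i, hi, (dist_triangle_right _ _ y).trans_lt (add_lt_add_of_lt_of_le hiy hxy)⟩

end BallsCover
end UnionOfBalls

/-- The part of the boundary of `S` on the positive side of a curve with signed distance `g`. The
part on the negative side is obtained from `-g`. -/
def positiveFrontier (g : Plane → ℝ) (S : Set Plane) : Set Plane := frontier S ∩ {x | 0 < g x}

lemma disjoint_pos_neg {X : Type*} (g : X → ℝ) : Disjoint {x | 0 < g x} {x | 0 < -g x} :=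
  disjoint_left.2 fun x (hpos : 0 < g x) (hneg : 0 < -g x) => lt_asymm hpos (neg_pos.1 hneg)

lemma eq_positiveFrontier_of_union_eq {g : Plane → ℝ} {S A B : Set Plane}
    (hAB : A ∪ B = frontier S) (hA : A ⊆ {x | 0 < g x}) (hB : B ⊆ {x | 0 < -g x}) :
    A = positiveFrontier g S := by
  have hdisj : Disjoint B {x | 0 < g x} := (disjoint_pos_neg g).symm.mono_left hB
  rw [positiveFrontier, ← hAB, union_inter_distrib_right, inter_eq_left.2 hA, hdisj.inter_eq,
    union_empty]

/-- The largest height `t ≤ Δ` at which the normal to the curve `f` at `f u` meets `S`. -/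
noncomputable def normalHeight (f N : ℝ → Plane) (Δ : ℝ) (S : Set Plane) (u : ℝ) : ℝ :=
  sSup {t ∈ Icc 0 Δ | f u + t • N u ∈ S}

lemma isCompact_setOf_normal_mem (f N : ℝ → Plane) (Δ : ℝ) {S : Set Plane} (hS : IsClosed S)
    (u : ℝ) : IsCompact {t ∈ Icc 0 Δ | f u + t • N u ∈ S} :=
  isCompact_Icc.inter_right (hS.preimage (by fun_prop : Continuous fun t : ℝ => f u + t • N u))

lemma le_normalHeight {f N : ℝ → Plane} {Δ t u : ℝ} {S : Set Plane} (hS : IsClosed S)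
    (ht : t ∈ Icc 0 Δ) (hmem : f u + t • N u ∈ S) : t ≤ normalHeight f N Δ S u :=
  le_csSup (isCompact_setOf_normal_mem f N Δ hS u).bddAbove ⟨ht, hmem⟩

lemma boundaryCurve_eq_offsetCurve {f N : ℝ → Plane} (hN : ∀ u, unitNormal f u = N u)
    (σ s : ℝ) :
    boundaryCurve f σ s = offsetCurve f (fun u => s • N u) σ := by
  simp only [boundaryCurve, offsetCurve, hN, smul_smul, mul_comm]

lemma boundaryCurve_neg_eq_offsetCurve {f N : ℝ → Plane} (hN : ∀ u, unitNormal f u = N u)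
    (σ s : ℝ) :
    boundaryCurve f σ (-s) = offsetCurve f (fun u => s • N u) (-σ) := by
  simp only [boundaryCurve, offsetCurve, hN, smul_smul, mul_comm, mul_neg]

namespace IsTube

variable {f N : ℝ → Plane} {g : Plane → ℝ} {Y : ℕ → Plane} {n : ℕ} {Δ σ ε d R s u : ℝ}
  {x : Plane} {A A₀ A₁ Γhat : Set Plane}

lemma signedDist_ne_zero (h : IsTube f N g Δ) (hc : BallsCover (filament f) Y n σ d R)
    (hd : 0 ≤ d) (hx : x ∈ frontier (unionOfBalls Y n R)) : g x ≠ 0 :=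
  abs_pos.1 (by rw [← h.infDist_filament]; exact hd.trans_lt (hc.lt_infDist hx))

lemma normalHeight_mem (h : IsTube f N g Δ) (hc : BallsCover (filament f) Y n σ d R) (hd : 0 ≤ d)
    (hu : u ∈ Icc (0 : ℝ) 1) :
    normalHeight f N Δ (unionOfBalls Y n R) u ∈ Icc 0 Δ ∧
      f u + normalHeight f N Δ (unionOfBalls Y n R) u • N u ∈ unionOfBalls Y n R := by
  refine (isCompact_setOf_normal_mem f N Δ (isClosed_unionOfBalls Y n R) u).sSup_mem
    ⟨0, ⟨le_rfl, h.radius_pos.le⟩, interior_subset (hc.mem_interior ?_)⟩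
  rwa [zero_smul, add_zero, infDist_zero_of_mem (mem_filament f hu)]

lemma signedDist_normalHeight (h : IsTube f N g Δ) (hc : BallsCover (filament f) Y n σ d R)
    (hd : 0 ≤ d) (hu : u ∈ Icc (0 : ℝ) 1) :
    g (f u + normalHeight f N Δ (unionOfBalls Y n R) u • N u) =
      normalHeight f N Δ (unionOfBalls Y n R) u := by
  obtain ⟨⟨hnonneg, hle⟩, -⟩ := h.normalHeight_mem hc hd hu
  exact h.apply_normal u hu _ (by rwa [abs_of_nonneg hnonneg])

lemma signedDist_le_of_mem_unionOfBalls (h : IsTube f N g Δ)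
    (hc : BallsCover (filament f) Y n σ d R) (hx : x ∈ unionOfBalls Y n R) : g x ≤ σ + R :=
  (le_abs_self _).trans (by rw [← h.infDist_filament]; exact hc.infDist_le hx)

lemma normalHeight_le (h : IsTube f N g Δ) (hc : BallsCover (filament f) Y n σ d R) (hd : 0 ≤ d)
    (hu : u ∈ Icc (0 : ℝ) 1) : normalHeight f N Δ (unionOfBalls Y n R) u ≤ σ + R := by
  rw [← h.signedDist_normalHeight hc hd hu]
  exact h.signedDist_le_of_mem_unionOfBalls hc (h.normalHeight_mem hc hd hu).2

lemma normalHeight_mem_positiveFrontier (h : IsTube f N g Δ)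
    (hc : BallsCover (filament f) Y n σ d R) (hd : 0 ≤ d) (hσR : σ + R < Δ)
    (hu : u ∈ Icc (0 : ℝ) 1) :
    f u + normalHeight f N Δ (unionOfBalls Y n R) u • N u ∈
      positiveFrontier g (unionOfBalls Y n R) := by
  set ρ := normalHeight f N Δ (unionOfBalls Y n R) u
  obtain ⟨⟨hρ, -⟩, hmem⟩ := h.normalHeight_mem hc hd hu
  have hfrontier : f u + ρ • N u ∈ frontier (unionOfBalls Y n R) := by
    refine mem_frontier_unionOfBalls.2 ⟨hmem, fun hinside => ?_⟩
    have hcont : ContinuousAt (fun t : ℝ => f u + t • N u) ρ := by fun_prop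
    have hev := hcont.eventually (isOpen_interior.mem_nhds hinside)
    obtain ⟨t, ht, hρt, htΔ⟩ := ((hev.filter_mono nhdsWithin_le_nhds).and
      (Ioo_mem_nhdsGT ((h.normalHeight_le hc hd hu).trans_lt hσR))).exists
    exact hρt.not_ge (le_normalHeight (isClosed_unionOfBalls Y n R) ⟨hρ.trans hρt.le, htΔ.le⟩
      (interior_subset ht))
  have hne := h.signedDist_ne_zero hc hd hfrontier
  refine ⟨hfrontier, ?_⟩
  rw [mem_ofPred_eq, h.signedDist_normalHeight hc hd hu] at *
  exact hρ.lt_of_ne' hne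

lemma lt_normalHeight (h : IsTube f N g Δ) (hc : BallsCover (filament f) Y n σ d R) (hd : 0 ≤ d)
    (hσR : σ + R < Δ) (hu : u ∈ Icc (0 : ℝ) 1) : d < normalHeight f N Δ (unionOfBalls Y n R) u := by
  have := hc.lt_infDist (h.normalHeight_mem_positiveFrontier hc hd hσR hu).1
  rwa [h.infDist_filament, h.signedDist_normalHeight hc hd hu,
    abs_of_nonneg (h.normalHeight_mem hc hd hu).1.1] at this

lemma positiveFrontier_nonempty (h : IsTube f N g Δ) (hc : BallsCover (filament f) Y n σ d R)
    (hd : 0 ≤ d) (hσR : σ + R < Δ) : (positiveFrontier g (unionOfBalls Y n R)).Nonempty :=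
  ⟨_, h.normalHeight_mem_positiveFrontier hc hd hσR (u := 0) (by simp)⟩

lemma isCompact_positiveFrontier (h : IsTube f N g Δ) (hc : BallsCover (filament f) Y n σ d R)
    (hd : 0 ≤ d) : IsCompact (positiveFrontier g (unionOfBalls Y n R)) := by
  have heq : positiveFrontier g (unionOfBalls Y n R) =
      frontier (unionOfBalls Y n R) ∩ {x | 0 ≤ g x} := by
    ext x
    exact and_congr_right fun hx =>
      (h.signedDist_ne_zero hc hd hx).symm.le_iff_lt.symm
  rw [heq]
  exact ((isCompact_unionOfBalls Y n R).of_isClosed_subset isClosed_frontier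
    (isClosed_unionOfBalls Y n R).frontier_subset).inter_right
    (isClosed_le continuous_const h.continuous_signedDist)

lemma hausdorffDist_offsetCurve_positiveFrontier_le (h : IsTube f N g Δ)
    (hc : BallsCover (filament f) Y n σ (σ - ε) R) (hR : R ≤ ε) (hεσ : ε ≤ σ)
    (hσε : σ + ε < Δ) :
    hausdorffDist (offsetCurve f N σ) (positiveFrontier g (unionOfBalls Y n R)) ≤ ε := by
  have hd : 0 ≤ σ - ε := sub_nonneg.2 hεσ
  have hσR : σ + R < Δ := by linarith
  refine hausdorffDist_le_of_mem_dist
    ((hc.radius_pos (filament_nonempty f) hd).le.trans hR) ?_ ?_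
  · rintro _ ⟨u, hu, rfl⟩
    refine ⟨_, h.normalHeight_mem_positiveFrontier hc hd hσR hu, ?_⟩
    rw [h.dist_offset hu, abs_le]
    have := h.lt_normalHeight hc hd hσR hu
    have := h.normalHeight_le hc hd hu
    constructor <;> linarith
  · rintro x ⟨hx, hpos⟩
    obtain ⟨u, hu, hdist⟩ := h.exists_dist_offset_eq x
    refine ⟨_, mem_offsetCurve f N σ hu, ?_⟩
    have hlt := hc.lt_infDist hx
    have hle := hc.infDist_le (mem_frontier_unionOfBalls.1 hx).1
    rw [h.infDist_filament, abs_of_pos hpos] at hlt hle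
    rw [hdist, abs_le]
    constructor <;> linarith

lemma hausdorffDist_le_of_positiveFrontier (h : IsTube f N g Δ)
    (hc : BallsCover (filament f) Y n σ (σ - ε) R) (hR : R ≤ ε) (hεσ : ε < σ)
    (hε : ε < (Δ - σ) / 2)
    (hm : IsMedialEstimator (positiveFrontier g (unionOfBalls Y n R))
      (positiveFrontier (fun x => -g x) (unionOfBalls Y n R)) Γhat) :
    hausdorffDist (filament f) Γhat ≤ medialConst σ Δ * √ε := by
  have hd : 0 ≤ σ - ε := sub_nonneg.2 hεσ.le
  have hR0 := hc.radius_pos (filament_nonempty f) hd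
  have hσR : σ + R < Δ := by linarith
  have hneg := h.neg.hausdorffDist_offsetCurve_positiveFrontier_le hc hR hεσ.le (by linarith)
  rw [offsetCurve_neg_normal] at hneg
  rw [hausdorffDist_comm]
  exact (h.medial_bound (by linarith) (by linarith) (h.isCompact_positiveFrontier hc hd)
    (h.positiveFrontier_nonempty hc hd hσR) (h.neg.isCompact_positiveFrontier hc hd)
    (h.neg.positiveFrontier_nonempty hc hd hσR)
    (h.hausdorffDist_offsetCurve_positiveFrontier_le hc hR hεσ.le (by linarith)) hneg hε hm).2.2

lemma subset_pos_or_subset_neg (h : IsTube f N g Δ) (hc : BallsCover (filament f) Y n σ d R)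
    (hd : 0 ≤ d) (hA : IsSimpleClosedCurve A) (hAD : A ⊆ frontier (unionOfBalls Y n R)) :
    A ⊆ {x | 0 < g x} ∨ A ⊆ {x | 0 < -g x} := by
  obtain ⟨γ, hγ, -, -, rfl⟩ := hA
  refine (isPreconnected_Icc.image _ hγ).subset_or_subset
    (isOpen_lt continuous_const h.continuous_signedDist)
    (isOpen_lt continuous_const h.continuous_signedDist.neg) (disjoint_pos_neg g) fun x hx => ?_
  exact (h.signedDist_ne_zero hc hd (hAD hx)).symm.lt_or_gt.imp id neg_pos.2

lemma eq_positiveFrontier_of_isTwoCurveSplitting (h : IsTube f N g Δ)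
    (hc : BallsCover (filament f) Y n σ d R) (hd : 0 ≤ d) (hσR : σ + R < Δ)
    (hsp : IsTwoCurveSplitting (frontier (unionOfBalls Y n R)) A₀ A₁) :
    A₀ = positiveFrontier g (unionOfBalls Y n R) ∧
        A₁ = positiveFrontier (fun x => -g x) (unionOfBalls Y n R) ∨
      A₁ = positiveFrontier g (unionOfBalls Y n R) ∧
        A₀ = positiveFrontier (fun x => -g x) (unionOfBalls Y n R) := by
  have hunion := hsp.union
  have hunion' := (union_comm A₁ A₀).trans hunion
  have two_sides : ∀ A B, A ∪ B = frontier (unionOfBalls Y n R) →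
      A ⊆ {x | 0 < g x} → B ⊆ {x | 0 < -g x} → A = positiveFrontier g (unionOfBalls Y n R) ∧
        B = positiveFrontier (fun x => -g x) (unionOfBalls Y n R) := fun A B hAB hA hB =>
    ⟨eq_positiveFrontier_of_union_eq hAB hA hB, eq_positiveFrontier_of_union_eq
      ((union_comm B A).trans hAB) hB (by simpa only [neg_neg] using hA)⟩
  have not_one_side : ∀ {g : Plane → ℝ}, A₀ ⊆ {x | 0 < g x} → A₁ ⊆ {x | 0 < g x} →
      ¬ (positiveFrontier (fun x => -g x) (unionOfBalls Y n R)).Nonempty := by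
    rintro g h₀ h₁ ⟨x, hx, hneg⟩
    exact disjoint_left.1 (disjoint_pos_neg g) (union_subset h₀ h₁ (hunion ▸ hx)) hneg
  rcases h.subset_pos_or_subset_neg hc hd hsp.curve₀ (hunion ▸ subset_union_left) with h₀ | h₀ <;>
    rcases h.subset_pos_or_subset_neg hc hd hsp.curve₁ (hunion ▸ subset_union_right) with h₁ | h₁
  · exact absurd (h.neg.positiveFrontier_nonempty hc hd hσR) (not_one_side h₀ h₁)
  · exact Or.inl (two_sides _ _ hunion h₀ h₁)
  · exact Or.inr (two_sides _ _ hunion' h₁ h₀)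
  · exact absurd (h.neg.neg.positiveFrontier_nonempty hc hd hσR) (not_one_side h₀ h₁)

theorem hausdorffDist_le_of_isTwoCurveSplitting (h : IsTube f N g Δ)
    (hc : BallsCover (filament f) Y n σ (σ - ε) R) (hR : R ≤ ε) (hεσ : ε < σ)
    (hε : ε < (Δ - σ) / 2) (hsp : IsTwoCurveSplitting (frontier (unionOfBalls Y n R)) A₀ A₁)
    (hm : IsMedialEstimator A₀ A₁ Γhat) :
    hausdorffDist (filament f) Γhat ≤ medialConst σ Δ * √ε := by
  have hd : 0 ≤ σ - ε := sub_nonneg.2 hεσ.le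
  have := hc.radius_pos (filament_nonempty f) hd
  rcases h.eq_positiveFrontier_of_isTwoCurveSplitting hc hd (by linarith) hsp with
    ⟨rfl, rfl⟩ | ⟨rfl, rfl⟩
  · exact h.hausdorffDist_le_of_positiveFrontier hc hR hεσ hε hm
  · exact h.neg.hausdorffDist_le_of_positiveFrontier hc hR hεσ hε (by simpa only [neg_neg] using hm)

lemma boundaryPart_eq_positiveFrontier (h : IsTube f N g Δ) (hN : ∀ u, unitNormal f u = N u)
    (hc : BallsCover (filament f) Y n σ d R) (hd : 0 ≤ d) (hσ : 0 < σ) (hσΔ : σ ≤ Δ)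
    (hs : s = 1 ∨ s = -1) :
    boundaryPart f σ s (frontier (unionOfBalls Y n R)) =
      positiveFrontier (fun x => s * g x) (unionOfBalls Y n R) := by
  ext x
  have hiff := (h.sign hs).infDist_offsetCurve_le_iff hσ hσΔ x
  rw [← boundaryCurve_eq_offsetCurve hN, ← boundaryCurve_neg_eq_offsetCurve hN] at hiff
  exact and_congr_right fun hx =>
    hiff.trans ((h.sign hs).signedDist_ne_zero hc hd hx).symm.le_iff_lt

theorem boundaryPart_nonempty_and_hausdorffDist_le (h : IsTube f N g Δ)
    (hN : ∀ u, unitNormal f u = N u) (hc : BallsCover (filament f) Y n σ (σ - ε) R)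
    (hR : R ≤ ε) (hεσ : ε < σ) (hε : ε < (Δ - σ) / 2) (hs : s = 1 ∨ s = -1) :
    (boundaryPart f σ s (frontier (unionOfBalls Y n R))).Nonempty ∧
    ∀ Γhat, IsMedialEstimator (boundaryPart f σ s (frontier (unionOfBalls Y n R)))
        (boundaryPart f σ (-s) (frontier (unionOfBalls Y n R))) Γhat →
      hausdorffDist (filament f) Γhat ≤ medialConst σ Δ * √ε := by
  have hd : 0 ≤ σ - ε := sub_nonneg.2 hεσ.le
  have hR0 := hc.radius_pos (filament_nonempty f) hd
  have hs' : -s = 1 ∨ -s = -1 := by rcases hs with rfl | rfl <;> simp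
  rw [h.boundaryPart_eq_positiveFrontier hN hc hd (by linarith) (by linarith) hs,
    h.boundaryPart_eq_positiveFrontier hN hc hd (by linarith) (by linarith) hs']
  simp only [neg_mul]
  exact ⟨(h.sign hs).positiveFrontier_nonempty hc hd (by linarith), fun Γhat hm =>
    (h.sign hs).hausdorffDist_le_of_positiveFrontier hc hR hεσ hε hm⟩

end IsTube

namespace IsTube

variable {f N : ℝ → Plane} {g : Plane → ℝ} {Y : ℕ → Plane} {n : ℕ} {Δ σ b R s t u : ℝ} {y : Plane}

lemma dist_lt_of_dist_le_of_lt (h : IsTube f N g Δ) (hu : u ∈ Icc (0 : ℝ) 1)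
    (hRb : 2 * R ^ 2 < b * (Δ - σ)) (hσΔ : σ < Δ) (hy : g y ≤ σ) (hbs : σ + b ≤ s) (hst : s < t)
    (htR : t ≤ σ + R) (hyt : dist y (f u + t • N u) ≤ R) : dist y (f u + s • N u) < R := by
  have hn := h.norm_normal u hu
  have hbelow := h.mul_inner_normal_le hu σ (hy.trans hσΔ.le)
  have hlevel : (Δ - σ) ^ 2 ≤ (Δ - g y) ^ 2 := by gcongr
  set ξ := y - (f u + σ • N u) with hξ
  have hdecomp : ∀ τ, y - (f u + τ • N u) = ξ - (τ - σ) • N u := by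
    intro τ; rw [hξ, sub_smul]; abel
  rw [dist_eq_norm, hdecomp] at hyt ⊢
  have hR0 : 0 ≤ R := (norm_nonneg _).trans hyt
  have hb : 0 < b :=
    pos_of_mul_pos_left ((by positivity : 0 ≤ 2 * R ^ 2).trans_lt hRb) (sub_pos.2 hσΔ).le
  have hξR : ‖ξ‖ ≤ 2 * R := by
    have := norm_le_norm_sub_add ξ ((t - σ) • N u)
    rw [norm_smul, hn, mul_one, Real.norm_of_nonneg (by linarith)] at this
    linarith
  have hinner : inner ℝ (N u) ξ < b := by
    have : ‖ξ‖ ^ 2 ≤ (2 * R) ^ 2 := by gcongr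
    by_contra! hb
    nlinarith
  apply lt_of_pow_lt_pow_left₀ 2 hR0
  have hsq : ‖ξ - (t - σ) • N u‖ ^ 2 ≤ R ^ 2 := by gcongr
  rw [norm_sub_sq_real, inner_smul_right, norm_smul, hn, mul_one, Real.norm_eq_abs, sq_abs,
    real_inner_comm] at hsq ⊢
  nlinarith

lemma mem_interior_of_lt_normalHeight (h : IsTube f N g Δ)
    (hc : BallsCover (filament f) Y n σ (σ + b) R) (hσb : 0 ≤ σ + b) (hσR : σ + R < Δ)
    (hRb : 2 * R ^ 2 < b * (Δ - σ)) (hu : u ∈ Icc (0 : ℝ) 1) (ht : 0 ≤ t)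
    (hlt : t < normalHeight f N Δ (unionOfBalls Y n R) u) :
    f u + t • N u ∈ interior (unionOfBalls Y n R) := by
  have hR := hc.radius_pos (filament_nonempty f) hσb
  rcases le_total t (σ + b) with htb | htb
  · refine hc.mem_interior ((infDist_le_dist_of_mem (mem_filament f hu)).trans ?_)
    simpa [norm_smul, h.norm_normal u hu, abs_of_nonneg ht] using htb
  · obtain ⟨i, hi, hit⟩ := mem_unionOfBalls.1 (h.normalHeight_mem hc hσb hu).2
    have hgY : g (Y i) ≤ σ :=
      (le_abs_self _).trans (by rw [← h.infDist_filament]; exact hc.near i hi)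
    exact mem_interior_unionOfBalls ⟨i, hi, h.dist_lt_of_dist_le_of_lt hu hRb (by linarith) hgY
      htb hlt (h.normalHeight_le hc hσb hu) hit⟩

lemma continuousOn_normalHeight (h : IsTube f N g Δ)
    (hc : BallsCover (filament f) Y n σ (σ + b) R) (hσb : 0 ≤ σ + b) (hσR : σ + R < Δ)
    (hRb : 2 * R ^ 2 < b * (Δ - σ)) :
    ContinuousOn (normalHeight f N Δ (unionOfBalls Y n R)) (Icc 0 1) := by
  set S := unionOfBalls Y n R
  have hclosed : IsClosed S := isClosed_unionOfBalls Y n R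
  have hltΔ : ∀ u ∈ Icc (0 : ℝ) 1, normalHeight f N Δ S u < Δ := fun u hu =>
    (h.normalHeight_le hc hσb hu).trans_lt hσR
  intro u hu
  have hpos := hσb.trans_lt (h.lt_normalHeight hc hσb hσR hu)
  refine tendsto_order.2 ⟨fun a ha => ?_, fun a ha => ?_⟩
  · obtain ⟨t, hat, htρ⟩ := exists_between (max_lt ha hpos)
    obtain ⟨hat, ht⟩ := max_lt_iff.1 hat
    filter_upwards [(h.continuousOn_offset t u hu).eventually
      (isOpen_interior.mem_nhds
        (h.mem_interior_of_lt_normalHeight hc hσb hσR hRb hu ht.le htρ))] with v hv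
    exact hat.trans_le (le_normalHeight hclosed ⟨ht.le, (htρ.trans (hltΔ u hu)).le⟩
      (interior_subset hv))
  · obtain ⟨t, htρ, hta⟩ := exists_between (lt_min ha (hltΔ u hu))
    obtain ⟨hta, htΔ⟩ := lt_min_iff.1 hta
    have ht : 0 ≤ t := (hpos.trans htρ).le
    filter_upwards [self_mem_nhdsWithin, (h.continuousOn_offset t u hu).eventually
      (hclosed.isOpen_compl.mem_nhds fun hmem =>
        htρ.not_ge (le_normalHeight hclosed ⟨ht, htΔ.le⟩ hmem))] with v hvI hv
    by_contra! hav
    exact hv (interior_subset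
      (h.mem_interior_of_lt_normalHeight hc hσb hσR hRb hvI ht (hta.trans_le hav)))

lemma image_normalHeight_eq_positiveFrontier (h : IsTube f N g Δ)
    (hc : BallsCover (filament f) Y n σ (σ + b) R) (hσb : 0 ≤ σ + b) (hσR : σ + R < Δ)
    (hRb : 2 * R ^ 2 < b * (Δ - σ)) :
    (fun u => f u + normalHeight f N Δ (unionOfBalls Y n R) u • N u) '' Icc 0 1 =
      positiveFrontier g (unionOfBalls Y n R) := by
  refine Subset.antisymm (image_subset_iff.2 fun u hu =>
    h.normalHeight_mem_positiveFrontier hc hσb hσR hu) ?_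
  rintro x ⟨hx, hpos : 0 < g x⟩
  obtain ⟨hxS, hxint⟩ := mem_frontier_unionOfBalls.1 hx
  obtain ⟨u, hu, hxu⟩ := h.exists_eq x
  have hgΔ : g x ≤ Δ := (h.signedDist_le_of_mem_unionOfBalls hc hxS).trans hσR.le
  have hle : g x ≤ normalHeight f N Δ (unionOfBalls Y n R) u :=
    le_normalHeight (isClosed_unionOfBalls Y n R) ⟨hpos.le, hgΔ⟩ (hxu ▸ hxS)
  have hge : normalHeight f N Δ (unionOfBalls Y n R) u ≤ g x := by
    by_contra! hlt
    exact hxint (hxu ▸ h.mem_interior_of_lt_normalHeight hc hσb hσR hRb hu hpos.le hlt)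
  refine ⟨u, hu, ?_⟩
  simpa only [hge.antisymm hle] using hxu.symm

lemma isSimpleClosedCurve_positiveFrontier (h : IsTube f N g Δ)
    (hc : BallsCover (filament f) Y n σ (σ + b) R) (hσb : 0 ≤ σ + b) (hσR : σ + R < Δ)
    (hRb : 2 * R ^ 2 < b * (Δ - σ)) :
    IsSimpleClosedCurve (positiveFrontier g (unionOfBalls Y n R)) := by
  refine ⟨fun u => f u + normalHeight f N Δ (unionOfBalls Y n R) u • N u,
    h.continuousOn.add ((h.continuousOn_normalHeight hc hσb hσR hRb).smul h.continuousOn_normal),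
    ?_, ?_, h.image_normalHeight_eq_positiveFrontier hc hσb hσR hRb⟩
  · simp only [normalHeight, h.closed, h.normal_closed]
  · intro u hu v hv huv
    have hu' := Ico_subset_Icc_self hu
    have hv' := Ico_subset_Icc_self hv
    have hheight := congrArg g huv
    simp only [h.signedDist_normalHeight hc hσb hu', h.signedDist_normalHeight hc hσb hv']
      at hheight
    simp only [← hheight] at huv
    exact h.injOn hu hv (h.eq_of_offset_eq (h.normalHeight_mem hc hσb hu').1.1
      ((h.normalHeight_le hc hσb hu').trans_lt hσR) hu' hv' huv)

theorem isTwoCurveSplitting_frontier (h : IsTube f N g Δ)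
    (hc : BallsCover (filament f) Y n σ (σ + b) R) (hσb : 0 ≤ σ + b) (hσR : σ + R < Δ)
    (hRb : 2 * R ^ 2 < b * (Δ - σ)) :
    IsTwoCurveSplitting (frontier (unionOfBalls Y n R))
      (positiveFrontier g (unionOfBalls Y n R))
      (positiveFrontier (fun x => -g x) (unionOfBalls Y n R)) where
  curve₀ := h.isSimpleClosedCurve_positiveFrontier hc hσb hσR hRb
  curve₁ := h.neg.isSimpleClosedCurve_positiveFrontier hc hσb hσR hRb
  disjoint := (disjoint_pos_neg g).mono inter_subset_right inter_subset_right
  union := by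
    rw [positiveFrontier, positiveFrontier, ← inter_union_distrib_left]
    exact inter_eq_left.2 fun x hx =>
      (h.signedDist_ne_zero hc hσb hx).symm.lt_or_gt.imp id neg_pos.2

end IsTube

section SampleCover

variable {Ω : Type*} [MeasurableSpace Ω] {P : Measure Ω} {f N : ℝ → Plane} {g : Plane → ℝ}
  {h : ℝ → ℝ} {φ : Plane → ℝ} {U : ℕ → Ω → ℝ} {e : ℕ → Ω → Plane} {C Δ ℓ σ β : ℝ}

lemma IsFilamentSample.ae_infDist_le (hs : IsFilamentSample P h φ U e)
    (hφ : ∀ x, σ < ‖x‖ → φ x = 0) :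
    ∀ᵐ ω ∂P, ∀ i, infDist (f (U i ω) + e i ω) (filament f) ≤ σ := by
  filter_upwards [hs.ae_mem hφ] with ω hω i
  exact (infDist_le_dist_of_mem (mem_filament f (hω i).1)).trans (by simpa using (hω i).2)

lemma exists_le_mul_rpow {c p : ℝ} (hc : 0 < c) (hp : 0 < p) (K₀ M : ℝ) :
    ∃ K, K₀ ≤ K ∧ M ≤ c * K ^ p := by
  obtain ⟨K, hK, hK₀⟩ := (((tendsto_rpow_atTop hp).eventually_ge_atTop (M / c)).and
    (eventually_ge_atTop K₀)).exists
  exact ⟨K, hK₀, (div_le_iff₀' hc).1 hK⟩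

variable [IsProbabilityMeasure P]

lemma exists_ae_eventually_ballsCover (ht : IsTube f N g Δ) (hℓ : 0 < ℓ)
    (hlip : ∀ u ∈ Icc (0 : ℝ) 1, ∀ v ∈ Icc (0 : ℝ) 1, ‖f v - f u‖ ≤ ℓ * |v - u|)
    (hσ : 0 < σ) (hσΔ : σ < Δ) (hhφ : HasDensityLowerBounds h φ σ β)
    (hs : IsFilamentSample P h φ U e) (hC : 0 < C) :
    ∃ K, 0 < K ∧ C ≤ K ∧ ∀ᵐ ω ∂P, ∀ᶠ n in atTop, BallsCover (filament f)
      (fun i => f (U i ω) + e i ω) n σ (σ - K * rate β n) (C * rate β n) := by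
  obtain ⟨M, -, hM⟩ := exists_ae_eventually_cover ht hℓ hlip hσ hσΔ hhφ hs
  have hβ := hhφ.exponent_nonneg
  obtain ⟨K, hCK, hMK⟩ := exists_le_mul_rpow (c := (C / 2) ^ 2) (p := β + 1 / 2) (by positivity)
    (by positivity) (2 * C) M
  refine ⟨K, by linarith, by linarith, ?_⟩
  filter_upwards [hM (C / 2) K (by positivity) (by linarith) hMK,
    hs.ae_infDist_le hhφ.support] with ω hω hnear
  filter_upwards [hω, eventually_ge_atTop 2] with n hn hn2
  have := rate_pos (β := β) hn2
  refine ⟨fun i _ => hnear i, fun x hx => ?_⟩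
  obtain ⟨i, hi, hix⟩ := hn x hx
  exact ⟨i, hi, hix.trans_lt (by gcongr; linarith)⟩

/-- For large `C` already balls of radius `C / 8 * rate β n` cover the points at depth
`C / 4 * rate β n`, so balls of the full radius reach `5 / 8 * (C * rate β n)` beyond the
`σ`-neighbourhood. -/
lemma exists_forall_ae_eventually_ballsCover (ht : IsTube f N g Δ) (hℓ : 0 < ℓ)
    (hlip : ∀ u ∈ Icc (0 : ℝ) 1, ∀ v ∈ Icc (0 : ℝ) 1, ‖f v - f u‖ ≤ ℓ * |v - u|)
    (hσ : 0 < σ) (hσΔ : σ < Δ) (hhφ : HasDensityLowerBounds h φ σ β)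
    (hs : IsFilamentSample P h φ U e) :
    ∃ C₀, 0 < C₀ ∧ ∀ C, C₀ < C → ∀ᵐ ω ∂P, ∀ᶠ n in atTop, BallsCover (filament f)
      (fun i => f (U i ω) + e i ω) n σ (σ + 5 / 8 * (C * rate β n)) (C * rate β n) := by
  obtain ⟨M, hM, hcover⟩ := exists_ae_eventually_cover ht hℓ hlip hσ hσΔ hhφ hs
  have hβ := hhφ.exponent_nonneg
  refine ⟨16 * (M + 1), by positivity, fun C hC => ?_⟩
  have hMC : M ≤ (C / 16) ^ 2 * (C / 4) ^ (β + 1 / 2) := calc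
    M ≤ (C / 16) ^ 2 * 1 := by nlinarith
    _ ≤ (C / 16) ^ 2 * (C / 4) ^ (β + 1 / 2) := by
      gcongr
      exact Real.one_le_rpow (by linarith) (by linarith)
  filter_upwards [hcover (C / 16) (C / 4) (by linarith) (by linarith) hMC,
    hs.ae_infDist_le hhφ.support] with ω hω hnear
  filter_upwards [hω, eventually_ge_atTop 2, eventually_mul_rate_lt hβ (C / 4) hσ]
    with n hn hn2 hdepth
  have hCr : 0 < C * rate β n := mul_pos (by linarith) (rate_pos hn2)
  have hc : BallsCover (filament f) (fun i => f (U i ω) + e i ω) n σ (σ - C / 4 * rate β n)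
      (C * rate β n / 8) := by
    refine ⟨fun i _ => hnear i, fun x hx => ?_⟩
    obtain ⟨i, hi, hix⟩ := hn x hx
    exact ⟨i, hi, by linarith⟩
  convert hc.enlarge (isCompact_filament ht.continuousOn) (filament_nonempty f) (by linarith)
    (b := 7 / 8 * (C * rate β n)) (by positivity) using 1 <;> ring

theorem exists_ae_eventually_hausdorffDist_le (ht : IsTube f N g Δ)
    (hN : ∀ u, unitNormal f u = N u) (hℓ : 0 < ℓ)
    (hlip : ∀ u ∈ Icc (0 : ℝ) 1, ∀ v ∈ Icc (0 : ℝ) 1, ‖f v - f u‖ ≤ ℓ * |v - u|)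
    (hσ : 0 < σ) (hσΔ : σ < Δ) (hhφ : HasDensityLowerBounds h φ σ β)
    (hs : IsFilamentSample P h φ U e) (hC : 0 < C) :
    ∃ K, 0 < K ∧ ∀ᵐ ω ∂P, ∀ᶠ n in atTop, ∀ D,
      D = frontier (unionOfBalls (fun i => f (U i ω) + e i ω) n (C * rate β n)) →
      (∀ A₀ A₁ Γhat, IsTwoCurveSplitting D A₀ A₁ → IsMedialEstimator A₀ A₁ Γhat →
        hausdorffDist (filament f) Γhat ≤ K * √(rate β n)) ∧
      (∀ s : ℝ, s = 1 ∨ s = -1 → (boundaryPart f σ s D).Nonempty ∧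
        ∀ Γhat, IsMedialEstimator (boundaryPart f σ s D) (boundaryPart f σ (-s) D) Γhat →
          hausdorffDist (filament f) Γhat ≤ K * √(rate β n)) := by
  obtain ⟨K, hK, hCK, hcover⟩ := exists_ae_eventually_ballsCover ht hℓ hlip hσ hσΔ hhφ hs hC
  have hβ := hhφ.exponent_nonneg
  refine ⟨medialConst σ Δ * √K, mul_pos (medialConst_pos ht.radius_pos) (Real.sqrt_pos.2 hK), ?_⟩
  filter_upwards [hcover] with ω hω
  filter_upwards [hω, eventually_ge_atTop 2, eventually_mul_rate_lt hβ K hσ,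
    eventually_mul_rate_lt hβ K (half_pos (sub_pos.2 hσΔ))] with n hc hn hKσ hKΔ D hD
  have hR : C * rate β n ≤ K * rate β n := by
    have := rate_pos (β := β) hn
    gcongr
  rw [hD, mul_assoc, ← Real.sqrt_mul hK.le]
  exact ⟨fun A₀ A₁ Γhat => ht.hausdorffDist_le_of_isTwoCurveSplitting hc hR hKσ hKΔ,
    fun s => ht.boundaryPart_nonempty_and_hausdorffDist_le hN hc hR hKσ hKΔ⟩

theorem exists_forall_ae_eventually_isTwoCurveSplitting (ht : IsTube f N g Δ) (hℓ : 0 < ℓ)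
    (hlip : ∀ u ∈ Icc (0 : ℝ) 1, ∀ v ∈ Icc (0 : ℝ) 1, ‖f v - f u‖ ≤ ℓ * |v - u|)
    (hσ : 0 < σ) (hσΔ : σ < Δ) (hhφ : HasDensityLowerBounds h φ σ β)
    (hs : IsFilamentSample P h φ U e) :
    ∃ C₀, ∀ C, C₀ < C → ∀ᵐ ω ∂P, ∀ᶠ n in atTop, ∃ A₀ A₁, IsTwoCurveSplitting
      (frontier (unionOfBalls (fun i => f (U i ω) + e i ω) n (C * rate β n))) A₀ A₁ := by
  obtain ⟨C₀, hC₀, hcover⟩ := exists_forall_ae_eventually_ballsCover ht hℓ hlip hσ hσΔ hhφ hs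
  refine ⟨C₀, fun C hC => ?_⟩
  filter_upwards [hcover C hC] with ω hω
  filter_upwards [hω, eventually_ge_atTop 2,
    eventually_mul_rate_lt hhφ.exponent_nonneg (4 * C) (sub_pos.2 hσΔ)] with n hc hn hsmall
  have hCr : 0 < C * rate β n := mul_pos (hC₀.trans hC) (rate_pos hn)
  exact ⟨_, _, ht.isTwoCurveSplitting_frontier hc (by positivity) (by linarith) (by nlinarith)⟩

end SampleCover

theorem mainTheorem4_general (f : ℝ → Plane) (σ : ℝ) (hf : IsClosedFilament f) (hσ : 0 < σ)
    (hΔ : σ < thickness (filament f)) :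
    (∃ C : ℝ, 0 < C ∧ ∀ s : ℝ, s = 1 ∨ s = -1 →
      ∀ (ε : ℝ) (A₀ A₁ Γhat : Set Plane),
        IsCompact A₀ → A₀.Nonempty → IsCompact A₁ → A₁.Nonempty →
        hausdorffDist (boundaryCurve f σ s) A₀ ≤ ε →
        hausdorffDist (boundaryCurve f σ (-s)) A₁ ≤ ε →
        ε < (thickness (filament f) - σ) / 2 →
        IsMedialEstimator A₀ A₁ Γhat →
          (∀ m ∈ Γhat, ∃ x ∈ filament f, ‖m - x‖ ≤ 2 * ε) ∧
          (∀ x ∈ filament f, ∃ m ∈ Γhat, ‖m - x‖ ≤ C * √ε) ∧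
          hausdorffDist Γhat (filament f) ≤ C * √ε) ∧
    (∀ (Ω : Type*) [MeasurableSpace Ω] (P : Measure Ω) [IsProbabilityMeasure P]
      (h : ℝ → ℝ) (φ : Plane → ℝ) (β : ℝ) (U : ℕ → Ω → ℝ) (e : ℕ → Ω → Plane),
      HasDensityLowerBounds h φ σ β → IsFilamentSample P h φ U e →
      (∀ C : ℝ, 0 < C →
        ∃ K : ℝ, 0 < K ∧ ∀ᵐ ω ∂P, ∀ᶠ n : ℕ in atTop,
          ∀ D : Set Plane,
            D = frontier (unionOfBalls (fun i => f (U i ω) + e i ω) n (C * rate β n)) →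
            (∀ A₀ A₁ Γhat : Set Plane, IsTwoCurveSplitting D A₀ A₁ →
              IsMedialEstimator A₀ A₁ Γhat →
              hausdorffDist (filament f) Γhat ≤ K * √(rate β n)) ∧
            (∀ s : ℝ, s = 1 ∨ s = -1 →
              (boundaryPart f σ s D).Nonempty ∧
              ∀ Γhat : Set Plane,
                IsMedialEstimator (boundaryPart f σ s D) (boundaryPart f σ (-s) D) Γhat →
                hausdorffDist (filament f) Γhat ≤ K * √(rate β n))) ∧
      (∃ C₀ : ℝ, ∀ C : ℝ, C₀ < C → ∀ᵐ ω ∂P, ∀ᶠ n : ℕ in atTop,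
        ∃ A₀ A₁ : Set Plane, IsTwoCurveSplitting
          (frontier (unionOfBalls (fun i => f (U i ω) + e i ω) n (C * rate β n))) A₀ A₁)) := by
  have hΔ₀ := hσ.trans hΔ
  obtain ⟨T, ℓ, hcurve, hN⟩ := hf.exists_isThickCurve hΔ₀
  have ht := hcurve.isTube
  have hℓ := hcurve.speed_pos
  have hlip : ∀ u ∈ Icc (0 : ℝ) 1, ∀ v ∈ Icc (0 : ℝ) 1, ‖f v - f u‖ ≤ ℓ * |v - u| :=
    fun u hu v hv => hcurve.norm_sub_le hu hv
  refine ⟨⟨medialConst σ (thickness (filament f)), medialConst_pos hΔ₀,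
      fun s hs ε A₀ A₁ Γhat hA₀ hA₀' hA₁ hA₁' h₀ h₁ => ?_⟩,
    fun Ω _ P _ h φ β U e hhφ hs => ⟨fun C hC => ?_, ?_⟩⟩
  · rw [boundaryCurve_eq_offsetCurve hN] at h₀
    rw [boundaryCurve_neg_eq_offsetCurve hN] at h₁
    exact (ht.sign hs).medial_bound hσ hΔ hA₀ hA₀' hA₁ hA₁' h₀ h₁
  · exact exists_ae_eventually_hausdorffDist_le ht hN hℓ hlip hσ hΔ hhφ hs hC
  · exact exists_forall_ae_eventually_isTwoCurveSplitting ht hℓ hlip hσ hΔ hhφ hs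

theorem mainTheorem4 (f : ℝ → Plane) (σ : ℝ) (hf : IsClosedFilament f) (hσ : 0 < σ)
    (hΔ : σ < thickness (filament f)) :
    -- deterministic part
    (∃ C : ℝ, 0 < C ∧ ∀ s : ℝ, s = 1 ∨ s = -1 →
      ∀ (ε : ℝ) (A₀ A₁ Γhat : Set Plane),
        IsCompact A₀ → A₀.Nonempty → IsCompact A₁ → A₁.Nonempty →
        hausdorffDist (boundaryCurve f σ s) A₀ ≤ ε →
        hausdorffDist (boundaryCurve f σ (-s)) A₁ ≤ ε →
        ε < (thickness (filament f) - σ) / 2 →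
        IsMedialEstimator A₀ A₁ Γhat →
          (∀ m ∈ Γhat, ∃ x ∈ filament f, ‖m - x‖ ≤ 2 * ε) ∧
          (∀ x ∈ filament f, ∃ m ∈ Γhat, ‖m - x‖ ≤ C * √ε) ∧
          hausdorffDist Γhat (filament f) ≤ C * √ε) ∧
    -- union-of-balls estimates of the boundary from a random sample
    (∀ (Ω : Type*) [MeasurableSpace Ω] (P : Measure Ω) [IsProbabilityMeasure P]
      (h : ℝ → ℝ) (φ : Plane → ℝ) (β : ℝ) (U : ℕ → Ω → ℝ) (e : ℕ → Ω → Plane),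
      IsPositionDensity h → IsNoiseDensity φ σ β → IsFilamentSample P h φ U e →
      (∀ C : ℝ, √(2 / ((1 / 4) * Real.pi)) < C →
        ∃ K : ℝ, 0 < K ∧ ∀ᵐ ω ∂P, ∀ᶠ n : ℕ in atTop,
          ∀ D : Set Plane,
            D = frontier (unionOfBalls (fun i => f (U i ω) + e i ω) n (C * rate β n)) →
            (∀ A₀ A₁ Γhat : Set Plane, IsTwoCurveSplitting D A₀ A₁ →
              IsMedialEstimator A₀ A₁ Γhat →
              hausdorffDist (filament f) Γhat ≤ K * √(rate β n)) ∧
            (∀ s : ℝ, s = 1 ∨ s = -1 →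
              (boundaryPart f σ s D).Nonempty ∧
              ∀ Γhat : Set Plane,
                IsMedialEstimator (boundaryPart f σ s D) (boundaryPart f σ (-s) D) Γhat →
                hausdorffDist (filament f) Γhat ≤ K * √(rate β n))) ∧
      (∃ C₀ : ℝ, ∀ C : ℝ, C₀ < C → ∀ᵐ ω ∂P, ∀ᶠ n : ℕ in atTop,
        ∃ A₀ A₁ : Set Plane, IsTwoCurveSplitting
          (frontier (unionOfBalls (fun i => f (U i ω) + e i ω) n (C * rate β n))) A₀ A₁)) := by
  obtain ⟨hdet, hrand⟩ := mainTheorem4_general f σ hf hσ hΔ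
  refine ⟨hdet, fun Ω _ P _ h φ β U e hh hφ hs => ?_⟩
  obtain ⟨ha, hb⟩ := hrand Ω P h φ β U e (hh.hasDensityLowerBounds hφ hσ) hs
  exact ⟨fun C hC => ha C ((Real.sqrt_nonneg _).trans_lt hC), hb⟩
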